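/- Let $k\ge 1$ be an integer, let $\ell\in\{0,\dots,k\}$, and let $q=e^{2\pi i\tau}$ with $\operatorname{Im}\tau>0$, where $q^a:=e^{2\pi i\tau a}$ for rational $a$. Write $(q)_n=\prod_{i=1}^n(1-q^i)$ for $n\ge 0$, $(q)_\infty=\prod_{i\ge1}(1-q^i)$, and $1/(q)_n=0$ for integers $n<0$. For integers $n,m$ let $\left[{n\atop m}\right]_q=\frac{(q)_n}{(q)_m(q)_{n-m}}$ if $0\le m\le n$, and $0$ otherwise. For integers $p,p',r,s,L,b$ with $p'\geq 1$ and $L+s+b$ even, let $$X^{(p,p')}_{r,s}(L,b;q)=\sum_{j\in\mathbb Z}\Bigl\{q^{j(pp'j+p'r-ps)}\left[{L\atop (L+s-b)/2-p'j}\right]_q-q^{(pj+r)(p'j+s)}\left[{L\atop (L-s-b)/2-p'j}\right]_q\Bigr\}.$$ For $t\in\mathbb Z$ let $$V_t(q)=\frac1{(q)_\infty}\sum_{i,j=0}^\infty\frac{q^{\binom{2j-2i-t}{2}+j}}{(q)_i(q)_j},\qquad \binom m2=\frac{m(m-1)}2,$$ and for $r\in\mathbb Z$ let $$\psi^{\mathrm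 B}_{\ell,r}(q)=\sum_{j\in\mathbb Z}q^{j((2k+3)j+2\ell+1)/2}\bigl\{V_{r-\ell-(2k+3)j}(q)-V_{r+\ell+1+(2k+3)j}(q)\bigr\},$$ $$\chi_{\ell,r}(q)=q^{-\frac{(\ell+r)^2}{4k}}\sum_{j\in\mathbb Z}q^{\frac12(2k+3)\left(j+\frac{2\ell+1}{2(2k+3)}\right)^2}\bigl\{V_{r-(2k+3)j}(q)-V_{r+2\ell+1+(2k+3)j}(q)\bigr\}.$$ Then all these series, and the double series over $(n,L)$ below, converge absolutely, and for every integer $r$ $$\psi^{\mathrm B}_{\ell,r}(q)=(q)_\infty\sum_{\substack{n\ge0\\ n\equiv r+\ell\ (\mathrm{mod}\ 2)}}\frac{q^{n^2/2}}{(q)_n}\sum_{L=0}^\infty\frac{q^{(2L+r-\ell)/2}}{(q)_L(q)_{L+r}}\sum_{\substack{0\le i\le k\\ i\equiv r\ (\mathrm{mod}\ 2)}}X^{(1,k+2)}_{1,i+1}(n,\ell+1;q^{-1})\,X^{(1,k+2)}_{1,i+1}(2L+r,1;q).$$ Consequently, for every integer $r$, $\psi^{\mathrm B}_{\ell,r}(q)=\psi^{\mathrm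 B}_{\ell,-r}(q)$, and the characters have the symmetry $\chi_{\ell,r}(q)=\chi_{\ell,-r-2\ell}(q)$. -/

import Mathlib

namespace GradedParafermion

/-- The power `q ^ a` with `q = exp (2 π i τ)` and a rational exponent `a`, that is,
`exp (2 π i τ a)`. In particular `q = qpow τ 1`. -/
noncomputable def qpow (τ : ℂ) (a : ℚ) : ℂ :=
  Complex.exp (2 * Real.pi * Complex.I * τ * a)

/-- `(q;q)_n = (1 - q) (1 - q ^ 2) ⋯ (1 - q ^ n)` for a natural number `n`. -/
noncomputable def qPoch (q : ℂ) (n : ℕ) : ℂ :=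
  ∏ i ∈ Finset.range n, (1 - q ^ (i + 1))

/-- `(q;q)_∞`. -/
noncomputable def qPochInf (q : ℂ) : ℂ :=
  ∏' i : ℕ, (1 - q ^ (i + 1))

/-- `1 / (q;q)_n` for an integer `n`; this is `0` for negative `n`, in agreement with the
extension `1 / (q;q)_n = (q ^ (n + 1);q)_∞ / (q;q)_∞`. -/
noncomputable def qPochInv (q : ℂ) (n : ℤ) : ℂ :=
  if 0 ≤ n then (qPoch q n.toNat)⁻¹ else 0

/-- The `q`-binomial coefficient for integers `n`, `m`: it is
`(q;q)_n / ((q;q)_m (q;q)_(n-m))` if `0 ≤ m ≤ n` and `0` otherwise. -/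
noncomputable def qBinom (q : ℂ) (n m : ℤ) : ℂ :=
  if 0 ≤ m ∧ m ≤ n then
    qPoch q n.toNat / (qPoch q m.toNat * qPoch q (n - m).toNat)
  else 0

/-- The `j`-th term of the one-dimensional configuration sum. It is used for
`L + s + b` even, when both divisions by `2` are exact. -/
noncomputable def configTerm (p p' r s L b : ℤ) (q : ℂ) (j : ℤ) : ℂ :=
  q ^ (j * (p * p' * j + p' * r - p * s)) * qBinom q L ((L + s - b) / 2 - p' * j)
    - q ^ ((p * j + r) * (p' * j + s)) * qBinom q L ((L - s - b) / 2 - p' * j)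

/-- The one-dimensional configuration sum `X_{r,s}^{(p,p')}(L,b;q)` of the
Andrews-Baxter-Forrester model. Only finitely many terms are nonzero when `p' ≥ 1`. -/
noncomputable def configSum (p p' r s L b : ℤ) (q : ℂ) : ℂ :=
  ∑' j : ℤ, configTerm p p' r s L b q j

/-- The `(i, j)`-th term of the double sum in the Verma character; the exponent is
`binom (2j - 2i - t) 2 + j`, where `binom m 2 = m (m - 1) / 2` (an exact division). -/
noncomputable def vermaTerm (t : ℤ) (q : ℂ) (ij : ℕ × ℕ) : ℂ :=
  q ^ ((2 * (ij.2 : ℤ) - 2 * ij.1 - t) * (2 * (ij.2 : ℤ) - 2 * ij.1 - t - 1) / 2 + ij.2)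
    / (qPoch q ij.1 * qPoch q ij.2)

/-- The Verma character `V_t(q)` of relative charge `t`. -/
noncomputable def verma (t : ℤ) (q : ℂ) : ℂ :=
  (qPochInf q)⁻¹ * ∑' ij : ℕ × ℕ, vermaTerm t q ij

/-- The `j`-th term of the bosonic sum. The division by `2` is exact, since
`j ((2k + 3) j + 2ℓ + 1)` is even. -/
noncomputable def psiTerm (k ℓ : ℕ) (r : ℤ) (q : ℂ) (j : ℤ) : ℂ :=
  q ^ (j * ((2 * k + 3) * j + 2 * ℓ + 1) / 2)
    * (verma (r - ℓ - (2 * k + 3) * j) q - verma (r + ℓ + 1 + (2 * k + 3) * j) q)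

/-- The bosonic sum `ψ^B_{ℓ,r}(q)` at level `k`. -/
noncomputable def psiB (k ℓ : ℕ) (r : ℤ) (q : ℂ) : ℂ :=
  ∑' j : ℤ, psiTerm k ℓ r q j

/-- The `j`-th term of the sum in the bosonic graded parafermion character. -/
noncomputable def chiTerm (k ℓ : ℕ) (r : ℤ) (τ : ℂ) (j : ℤ) : ℂ :=
  qpow τ ((2 * k + 3) / 2 * (j + (2 * ℓ + 1) / (2 * (2 * k + 3))) ^ 2)
    * (verma (r - (2 * k + 3) * j) (qpow τ 1)
      - verma (r + 2 * ℓ + 1 + (2 * k + 3) * j) (qpow τ 1))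

/-- The graded parafermion character `χ_{ℓ,r}(q)`, `q = exp (2 π i τ)`, of Dynkin label `ℓ`
and relative charge `r` at level `k`, as an alternating sum of Verma characters. -/
noncomputable def chiB (k ℓ : ℕ) (r : ℤ) (τ : ℂ) : ℂ :=
  qpow τ (-(ℓ + r) ^ 2 / (4 * k)) * ∑' j : ℤ, chiTerm k ℓ r τ j

/-- The `(n, L)`-th term of the double sum that represents `ψ^B_{ℓ,r}(q)`, without the
parity condition on `n`. -/
noncomputable def coupledTerm (k ℓ : ℕ) (r : ℤ) (τ : ℂ) (n L : ℕ) : ℂ :=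
  qpow τ ((n : ℚ) ^ 2 / 2) / qPoch (qpow τ 1) n
    * (qpow τ ((2 * L + r - ℓ) / 2)
        * qPochInv (qpow τ 1) L * qPochInv (qpow τ 1) (L + r)
      * ∑ i ∈ (Finset.range (k + 1)).filter (fun i : ℕ => (i : ℤ) ≡ r [ZMOD 2]),
          configSum 1 (k + 2) 1 (i + 1) n (ℓ + 1) (qpow τ 1)⁻¹
            * configSum 1 (k + 2) 1 (i + 1) (2 * L + r) 1 (qpow τ 1))

end GradedParafermion

open GradedParafermion

open Filter Topology

namespace GradedParafermion

/-! ### Finite and infinite q-factorials: recursions, limits and uniform bounds -/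

section Pochhammer

variable {q : ℂ}

/-! Write E(a) = ∑_k q^k / ((q)_k (q)_{k+a}) (`chargeSum`). Grouping the double series of V_t by a =
j - i gives V_t = (q)_∞⁻¹ ∑_a q^{binom(2a-t, 2) + a} E(a). A telescoping sum shows E(a-1) + q^a E(a)
= (q)_∞⁻². Inserting this with r+1-a in place of a splits V_t into (q)_∞ times a series in the
products E(a) E(r-a) and a remainder invariant under t ↦ 2r+1-t. The two Verma characters in each
term of ψ^B are exchanged by this reflection, so the remainders cancel (`verma_sub_verma`).

The bridge to the double sum consists of two evaluations: `pairSum_eq` expands (q)_∞ E(x) E(y) as a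
single series over L, and `durfeeSum_eq` is the Durfee rectangle identity. Both rest on uniqueness:
a solution of f(x-1) + q^x f(x) = 0 bounded on x ≥ 0 is zero (`eq_zero_of_recursion`).

Both sides of the main identity are then iterated sums of the same absolutely convergent fourfold
series over d, L, u, j (`kernelTerm`), taken in two versions that are subtracted. Summing over d and
L first gives ψ^B (`hasSum_psiTerm`). Fixing L and w = d + u and summing over j, then u, gives the
double sum (`hasSum_foldedTerm`): the j-sum is X(2L+r, 1; q), and the u-sum folds into the alcove 0
≤ i ≤ k. Folding works because X_{1,s} is antisymmetric, up to powers of q, under the affine Weyl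
group generated by s ↦ -s and s ↦ s + 2(k+2), and these powers cancel those occurring in X(n, ℓ+1;
q⁻¹) (`sum_configSum_mul_configSum`).

In the double sum the shift L ↦ L + r exchanges r and -r. Finally χ_{ℓ,r} is ψ^B_{ℓ,r+ℓ} times a
power of q depending on r only through (ℓ+r)², which transfers the symmetry. -/

theorem one_sub_pow_ne_zero (hq1 : ‖q‖ < 1) (n : ℕ) : 1 - q ^ (n + 1) ≠ 0 := by
  intro h
  have h1 : ‖q ^ (n + 1)‖ = 1 := by rw [← sub_eq_zero.mp h, norm_one]
  rw [norm_pow] at h1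
  exact absurd h1 (pow_lt_one₀ (norm_nonneg _) hq1 n.succ_ne_zero).ne

theorem qPoch_ne_zero (hq1 : ‖q‖ < 1) (n : ℕ) : qPoch q n ≠ 0 :=
  Finset.prod_ne_zero_iff.mpr fun i _ => one_sub_pow_ne_zero hq1 i

theorem qPoch_succ (q : ℂ) (n : ℕ) : qPoch q (n + 1) = qPoch q n * (1 - q ^ (n + 1)) := by
  rw [qPoch, Finset.prod_range_succ, ← qPoch]

theorem multipliable_one_sub_pow_succ (hq1 : ‖q‖ < 1) :
    Multipliable fun i : ℕ => 1 - q ^ (i + 1) :=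
  ModularForm.multipliable_one_sub_pow hq1

theorem qPochInf_ne_zero (hq1 : ‖q‖ < 1) : qPochInf q ≠ 0 := by
  have := tprod_one_add_ne_zero_of_summable (f := fun n : ℕ => -q ^ (n + 1))
    (fun i => by simpa [sub_eq_add_neg] using one_sub_pow_ne_zero hq1 i) (by
      simp only [norm_neg, norm_pow]
      exact (summable_nat_add_iff 1).mpr (summable_geometric_of_lt_one (norm_nonneg _) hq1))
  simpa [qPochInf, sub_eq_add_neg] using this

theorem tendsto_qPoch (hq1 : ‖q‖ < 1) : Tendsto (qPoch q) atTop (𝓝 (qPochInf q)) :=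
  (multipliable_one_sub_pow_succ hq1).hasProd.tendsto_prod_nat

theorem qPochInv_natCast (q : ℂ) (n : ℕ) : qPochInv q n = (qPoch q n)⁻¹ := by
  simp [qPochInv]

theorem qPochInv_of_neg (q : ℂ) {n : ℤ} (hn : n < 0) : qPochInv q n = 0 := by
  simp [qPochInv, hn]

theorem qPochInv_zero (q : ℂ) : qPochInv q 0 = 1 := by
  simp [qPochInv, qPoch]

theorem qPochInv_sub_one (hq1 : ‖q‖ < 1) (n : ℤ) :
    qPochInv q (n - 1) = (1 - q ^ n) * qPochInv q n := by
  rcases lt_trichotomy n 0 with h | rfl | h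
  · rw [qPochInv_of_neg q h, qPochInv_of_neg q (by lia), mul_zero]
  · rw [qPochInv_of_neg q (by lia)]; simp
  · obtain ⟨m, rfl⟩ : ∃ m : ℕ, n = (m : ℤ) + 1 := ⟨(n - 1).toNat, by lia⟩
    have : ((m : ℤ) + 1) = ((m + 1 : ℕ) : ℤ) := by push_cast; rfl
    rw [add_sub_cancel_right, this, qPochInv_natCast, qPochInv_natCast, qPoch_succ, zpow_natCast]
    have h1 := one_sub_pow_ne_zero hq1 m
    have h2 := qPoch_ne_zero hq1 m
    field_simp

theorem qPoch_toNat_mul_qPochInv (hq1 : ‖q‖ < 1) {n : ℤ} (hn : 0 ≤ n) :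
    qPoch q n.toNat * qPochInv q n = 1 := by
  rw [qPochInv, if_pos hn, mul_inv_cancel₀ (qPoch_ne_zero hq1 _)]

theorem qPoch_toNat_of_pos (q : ℂ) {n : ℤ} (hn : 0 < n) :
    qPoch q n.toNat = qPoch q (n - 1).toNat * (1 - q ^ n) := by
  obtain ⟨m, rfl⟩ : ∃ m : ℕ, n = (m : ℤ) + 1 := ⟨(n - 1).toNat, by lia⟩
  have : ((m : ℤ) + 1) = ((m + 1 : ℕ) : ℤ) := by push_cast; rfl
  rw [add_sub_cancel_right, this, Int.toNat_natCast, Int.toNat_natCast, qPoch_succ, zpow_natCast]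

theorem tendsto_qPochInv_add (hq1 : ‖q‖ < 1) (b : ℤ) :
    Tendsto (fun n : ℕ => qPochInv q (n + b)) atTop (𝓝 (qPochInf q)⁻¹) := by
  have h1 : Tendsto (fun n : ℕ => (n + b : ℤ).toNat) atTop atTop :=
    tendsto_atTop_mono' _ (f₁ := fun n : ℕ => n - b.natAbs)
      (Eventually.of_forall fun n => by dsimp only; lia) (tendsto_sub_atTop_nat _)
  have h2 := ((tendsto_qPoch hq1).inv₀ (qPochInf_ne_zero hq1)).comp h1
  refine h2.congr' ?_
  filter_upwards [eventually_ge_atTop b.natAbs] with n hn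
  simp only [Function.comp, qPochInv]
  rw [if_pos (by lia)]

theorem tendsto_qPoch_toNat_add (hq1 : ‖q‖ < 1) (b : ℤ) :
    Tendsto (fun n : ℕ => qPoch q (2 * n + b : ℤ).toNat) atTop (𝓝 (qPochInf q)) := by
  have h1 : Tendsto (fun n : ℕ => (2 * n + b : ℤ).toNat) atTop atTop :=
    tendsto_atTop_mono' _ (f₁ := fun n : ℕ => n - b.natAbs)
      (Eventually.of_forall fun n => by dsimp only; lia) (tendsto_sub_atTop_nat _)
  exact (tendsto_qPoch hq1).comp h1

theorem exists_norm_qPochInv_le (hq1 : ‖q‖ < 1) :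
    ∃ C : ℝ, 0 < C ∧ ∀ n : ℤ, ‖qPochInv q n‖ ≤ C := by
  obtain ⟨C, hC⟩ := (Metric.isBounded_range_of_tendsto _ (tendsto_qPochInv_add hq1 0)).exists_norm_le
  refine ⟨max C 1, by positivity, fun n => ?_⟩
  rcases lt_or_ge n 0 with h | h
  · rw [qPochInv_of_neg q h, norm_zero]; positivity
  · lift n to ℕ using h
    exact (hC _ ⟨n, by simp⟩).trans (le_max_left _ _)

theorem exists_norm_qPoch_le (hq1 : ‖q‖ < 1) :
    ∃ C : ℝ, 0 < C ∧ ∀ n : ℕ, ‖qPoch q n‖ ≤ C := by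
  obtain ⟨C, hC⟩ := (Metric.isBounded_range_of_tendsto _ (tendsto_qPoch hq1)).exists_norm_le
  exact ⟨max C 1, by positivity, fun n => (hC _ ⟨n, rfl⟩).trans (le_max_left _ _)⟩

end Pochhammer

/-! ### Series over the integers: geometric bounds, telescoping and a uniqueness principle -/

section IntegerSums

/-- The geometric sequence on the nonnegative integers, extended by zero. -/
noncomputable def geomInd (Q : ℝ) (n : ℤ) : ℝ := if 0 ≤ n then Q ^ n else 0

theorem geomInd_nonneg {Q : ℝ} (hQ : 0 ≤ Q) (n : ℤ) : 0 ≤ geomInd Q n := by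
  unfold geomInd; split_ifs <;> positivity

theorem hasSum_int_iff_of_neg {E : Type*} [AddCommMonoid E] [TopologicalSpace E] {f : ℤ → E} {a : E}
    (hf : ∀ n < 0, f n = 0) : HasSum (fun n : ℕ => f n) a ↔ HasSum f a :=
  Function.Injective.hasSum_iff (f := f) Nat.cast_injective fun x hx => hf x (by
    by_contra h
    exact hx ⟨x.toNat, by simp; lia⟩)

theorem hasSum_geomInd {Q : ℝ} (hQ : 0 ≤ Q) (hQ1 : Q < 1) :
    HasSum (geomInd Q) (1 - Q)⁻¹ := by
  rw [← hasSum_int_iff_of_neg (fun n hn => by simp [geomInd, hn])]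
  simpa [geomInd] using hasSum_geometric_of_lt_one hQ hQ1

theorem summable_of_norm_le_geomInd {Q C : ℝ} (hQ : 0 ≤ Q) (hQ1 : Q < 1) {f : ℤ → ℂ}
    (hf : ∀ n, ‖f n‖ ≤ C * geomInd Q n) : Summable f :=
  Summable.of_norm_bounded ((hasSum_geomInd hQ hQ1).summable.mul_left C) hf

theorem norm_tsum_le_of_norm_le_geomInd {Q C : ℝ} (hQ : 0 ≤ Q) (hQ1 : Q < 1) {f : ℤ → ℂ}
    (hf : ∀ n, ‖f n‖ ≤ C * geomInd Q n) : ‖∑' n, f n‖ ≤ C * (1 - Q)⁻¹ :=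
  tsum_of_norm_bounded ((hasSum_geomInd hQ hQ1).mul_left C) hf

/-- A telescoping sum over the integers whose partial sums `W` vanish on the negative integers. -/
theorem tsum_eq_of_sub_eq {f W : ℤ → ℂ} {a : ℂ} (hf : Summable f) (hW : ∀ n < 0, W n = 0)
    (h : ∀ n, W n - W (n - 1) = f n) (hlim : Tendsto (fun n : ℕ => W n) atTop (𝓝 a)) :
    ∑' n, f n = a := by
  have hneg : ∀ n < 0, f n = 0 := fun n hn => by
    rw [← h, hW n hn, hW (n - 1) (by lia), sub_zero]
  have h1 := ((hasSum_int_iff_of_neg hneg).mpr hf.hasSum).tendsto_sum_nat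
  have h2 : ∀ n : ℕ, ∑ i ∈ Finset.range n, f i = W ((n : ℤ) - 1) := by
    intro n
    induction n with
    | zero => simp [hW]
    | succ n ih =>
      rw [Finset.sum_range_succ, ih, ← h]; push_cast; rw [add_sub_cancel_right]; ring
  have h3 := (tendsto_add_atTop_iff_nat 1).mpr h1
  refine tendsto_nhds_unique h3 (hlim.congr fun n => ?_)
  rw [h2]; push_cast; rw [add_sub_cancel_right]

/-- A bounded solution of the recursion `d (x - 1) = - q ^ x d x` vanishes. -/
theorem eq_zero_of_recursion {q : ℂ} (hq1 : ‖q‖ < 1) {d : ℤ → ℂ} {C : ℝ}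
    (hC : ∀ x, 0 ≤ x → ‖d x‖ ≤ C) (hd : ∀ x, d (x - 1) = -(q ^ x * d x)) (x : ℤ) : d x = 0 := by
  have hpos : ∀ x : ℕ, d x = 0 := by
    have hstep : ∀ x : ℕ, ‖d x‖ ≤ ‖q‖ * ‖d (x + 1 : ℕ)‖ := fun x => by
      have := hd (x + 1 : ℕ)
      push_cast at this
      rw [add_sub_cancel_right] at this
      rw [this, norm_neg, norm_mul, norm_zpow]
      push_cast
      refine mul_le_mul_of_nonneg_right ?_ (norm_nonneg _)
      have h2 : ((x : ℤ) + 1) = ((x + 1 : ℕ) : ℤ) := by push_cast; rfl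
      rw [h2, zpow_natCast]
      exact pow_le_of_le_one (norm_nonneg _) hq1.le x.succ_ne_zero
    -- For x ≥ 0 the recursion expresses d x through d (x + 1) with a factor of norm at most ‖q‖, so
    -- iterating upwards gains ‖q‖ ^ n against the fixed bound C.
    have hiter : ∀ n x : ℕ, ‖d x‖ ≤ ‖q‖ ^ n * C := by
      intro n
      induction n with
      | zero => intro x; simpa using hC x (by positivity)
      | succ n ih =>
        intro x
        calc ‖d x‖ ≤ ‖q‖ * ‖d (x + 1 : ℕ)‖ := hstep x
          _ ≤ ‖q‖ * (‖q‖ ^ n * C) := mul_le_mul_of_nonneg_left (ih _) (norm_nonneg _)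
          _ = _ := by ring
    intro x
    have hlim : Tendsto (fun n : ℕ => ‖q‖ ^ n * C) atTop (𝓝 0) := by
      simpa using (tendsto_pow_atTop_nhds_zero_of_lt_one (norm_nonneg _) hq1).mul_const C
    exact norm_le_zero_iff.mp (ge_of_tendsto' hlim fun n => hiter n x)
  -- Downwards the recursion is explicit, so no bound on the negative side is needed.
  have hneg : ∀ x : ℕ, d (-x) = 0 := by
    intro x
    induction x with
    | zero => simpa using hpos 0
    | succ x ih =>
      have := hd (-x)
      rw [ih] at this
      push_cast
      rw [neg_add, ← sub_eq_add_neg, this]; simp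
  rcases Int.eq_nat_or_neg x with ⟨n, rfl | rfl⟩
  exacts [hpos n, hneg n]

end IntegerSums

/-! ### Evaluation of the charge, pair and Durfee series -/

section

variable {q : ℂ}

/-- The summand of `∑ q ^ k / ((q)_k (q)_(k+b))`. -/
noncomputable def chargeTerm (q : ℂ) (b k : ℤ) : ℂ := q ^ k * qPochInv q k * qPochInv q (k + b)

noncomputable def chargeSum (q : ℂ) (b : ℤ) : ℂ := ∑' k, chargeTerm q b k

theorem exists_norm_chargeTerm_le (hq1 : ‖q‖ < 1) :
    ∃ C : ℝ, 0 < C ∧ ∀ b k, ‖chargeTerm q b k‖ ≤ C * geomInd ‖q‖ k := by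
  obtain ⟨C, hC, h⟩ := exists_norm_qPochInv_le hq1
  refine ⟨C * C, by positivity, fun b k => ?_⟩
  rcases lt_or_ge k 0 with hk | hk
  · simp [chargeTerm, qPochInv_of_neg q hk, geomInd, hk.not_ge]
  · rw [chargeTerm, geomInd, if_pos hk, norm_mul, norm_mul, norm_zpow]
    calc _ ≤ ‖q‖ ^ k * C * C := by gcongr <;> apply h
      _ = _ := by ring

theorem summable_chargeTerm (hq1 : ‖q‖ < 1) (b : ℤ) : Summable (chargeTerm q b) := by
  obtain ⟨C, -, h⟩ := exists_norm_chargeTerm_le hq1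
  exact summable_of_norm_le_geomInd (norm_nonneg _) hq1 (h b)

theorem hasSum_chargeTerm (hq1 : ‖q‖ < 1) (b : ℤ) : HasSum (chargeTerm q b) (chargeSum q b) :=
  (summable_chargeTerm hq1 b).hasSum

theorem exists_norm_chargeSum_le (hq1 : ‖q‖ < 1) :
    ∃ C : ℝ, 0 < C ∧ ∀ b, ‖chargeSum q b‖ ≤ C := by
  obtain ⟨C, hC, h⟩ := exists_norm_chargeTerm_le hq1
  have : 0 < 1 - ‖q‖ := sub_pos.mpr hq1
  exact ⟨C * (1 - ‖q‖)⁻¹, by positivity,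
    fun b => norm_tsum_le_of_norm_le_geomInd (norm_nonneg _) hq1 (h b)⟩

/-- The combined summand is the backward difference of 1 / ((q)_k (q)_{k+a}), so the sum telescopes
to the limit of that product. -/
theorem chargeSum_sub_one_add (hq0 : q ≠ 0) (hq1 : ‖q‖ < 1) (a : ℤ) :
    chargeSum q (a - 1) + q ^ a * chargeSum q a = (qPochInf q)⁻¹ ^ 2 := by
  have s1 := summable_chargeTerm hq1 (a - 1)
  have s2 := (summable_chargeTerm hq1 a).mul_left (q ^ a)
  rw [chargeSum, chargeSum, ← tsum_mul_left, ← s1.tsum_add s2]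
  refine tsum_eq_of_sub_eq (W := fun k => qPochInv q k * qPochInv q (k + a)) (s1.add s2)
    (fun n hn => by simp [qPochInv_of_neg q hn]) (fun n => ?_) ?_
  · have e1 := qPochInv_sub_one hq1 n
    have e2 := qPochInv_sub_one hq1 (n + a)
    have e3 : n - 1 + a = n + a - 1 := by ring
    have e4 : n + (a - 1) = n + a - 1 := by ring
    simp only [chargeTerm, e3, e4, e1, e2, zpow_add₀ hq0]
    ring
  · simpa [pow_two] using (tendsto_qPochInv_add hq1 0).mul (tendsto_qPochInv_add hq1 a)

/-- The summand of the symmetric sum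
`∑ q ^ L (q)_(2L+x+y) / ((q)_L (q)_(L+x+y) (q)_(L+x) (q)_(L+y))`, without the power of `q`. -/
noncomputable def pairWeight (q : ℂ) (x y L : ℤ) : ℂ :=
  qPoch q (2 * L + (x + y)).toNat * qPochInv q L * qPochInv q (L + (x + y)) * qPochInv q (L + x)
    * qPochInv q (L + y)

noncomputable def pairSum (q : ℂ) (x y : ℤ) : ℂ := ∑' L : ℤ, q ^ L * pairWeight q x y L

theorem pairWeight_of_neg (q : ℂ) (x y : ℤ) {L : ℤ} (hL : L < 0) : pairWeight q x y L = 0 := by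
  simp [pairWeight, qPochInv_of_neg q hL]

theorem pairWeight_of_sum_neg (q : ℂ) (x y : ℤ) {L : ℤ} (hL : 2 * L + (x + y) < 0) :
    pairWeight q x y L = 0 := by
  rcases lt_or_ge (L + x) 0 with h | h
  · simp [pairWeight, qPochInv_of_neg q h]
  · simp [pairWeight, qPochInv_of_neg q (show L + y < 0 by lia)]

theorem exists_norm_pairWeight_le (hq1 : ‖q‖ < 1) :
    ∃ C : ℝ, 0 < C ∧ ∀ x y L, ‖pairWeight q x y L‖ ≤ C := by
  obtain ⟨C, hC, h⟩ := exists_norm_qPochInv_le hq1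
  obtain ⟨D, hD, h'⟩ := exists_norm_qPoch_le hq1
  refine ⟨D * C * C * C * C, by positivity, fun x y L => ?_⟩
  simp only [pairWeight, norm_mul]
  gcongr <;> first | apply h | apply h'

theorem exists_norm_pairTerm_le (hq1 : ‖q‖ < 1) :
    ∃ C : ℝ, 0 < C ∧ ∀ x y L, ‖q ^ L * pairWeight q x y L‖ ≤ C * geomInd ‖q‖ L := by
  obtain ⟨C, hC, h⟩ := exists_norm_pairWeight_le hq1
  refine ⟨C, hC, fun x y L => ?_⟩
  rcases lt_or_ge L 0 with hL | hL
  · simp [pairWeight_of_neg q x y hL, geomInd, hL.not_ge]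
  · rw [geomInd, if_pos hL, norm_mul, norm_zpow, mul_comm]
    gcongr
    apply h

theorem summable_pairTerm (hq1 : ‖q‖ < 1) (x y : ℤ) :
    Summable fun L => q ^ L * pairWeight q x y L := by
  obtain ⟨C, -, h⟩ := exists_norm_pairTerm_le hq1
  exact summable_of_norm_le_geomInd (norm_nonneg _) hq1 (h x y)

theorem hasSum_pairTerm (hq1 : ‖q‖ < 1) (x y : ℤ) :
    HasSum (fun L => q ^ L * pairWeight q x y L) (pairSum q x y) :=
  (summable_pairTerm hq1 x y).hasSum

theorem exists_norm_pairSum_le (hq1 : ‖q‖ < 1) :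
    ∃ C : ℝ, 0 < C ∧ ∀ x y, ‖pairSum q x y‖ ≤ C := by
  obtain ⟨C, hC, h⟩ := exists_norm_pairTerm_le hq1
  have : 0 < 1 - ‖q‖ := sub_pos.mpr hq1
  exact ⟨C * (1 - ‖q‖)⁻¹, by positivity,
    fun x y => norm_tsum_le_of_norm_le_geomInd (norm_nonneg _) hq1 (h x y)⟩

theorem pairWeight_sub_one (hq0 : q ≠ 0) (hq1 : ‖q‖ < 1) (x y L : ℤ) :
    pairWeight q x y L - pairWeight q x y (L - 1)
      = q ^ L * (pairWeight q (x - 1) (y - 1) L + q ^ x * pairWeight q x (y - 1) L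
        + q ^ y * pairWeight q (x - 1) y L + q ^ x * q ^ y * pairWeight q x y L) := by
  have a1 : L - 1 + (x + y) = L + (x + y) - 1 := by ring
  have a2 : L - 1 + x = L + x - 1 := by ring
  have a3 : L - 1 + y = L + y - 1 := by ring
  have a4 : L + (x - 1 + (y - 1)) = L + (x + y) - 1 - 1 := by ring
  have a5 : L + (x - 1) = L + x - 1 := by ring
  have a6 : L + (y - 1) = L + y - 1 := by ring
  have a7 : L + (x + (y - 1)) = L + (x + y) - 1 := by ring
  have a8 : L + (x - 1 + y) = L + (x + y) - 1 := by ring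
  have e1 := qPochInv_sub_one hq1 L
  have e2 := qPochInv_sub_one hq1 (L + (x + y))
  have e3 := qPochInv_sub_one hq1 (L + (x + y) - 1)
  have e4 := qPochInv_sub_one hq1 (L + x)
  have e5 := qPochInv_sub_one hq1 (L + y)
  have z1 : q ^ (L + (x + y) - 1) = q ^ L * q ^ x * q ^ y * q⁻¹ := by
    simp only [zpow_add₀ hq0, zpow_sub₀ hq0, zpow_one]; field_simp
  have z2 : q ^ (L + (x + y)) = q ^ L * q ^ x * q ^ y := by
    simp only [zpow_add₀ hq0]; ring
  -- The generic identity lowers the index of (q)_{2L+x+y} twice, which `toNat` permits only from 2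
  -- on. Below that almost all weights vanish, and the values 0 and 1 are checked by hand.
  rcases lt_or_ge (2 * L + (x + y)) 2 with h2 | h2
  · rcases lt_trichotomy (2 * L + (x + y)) 0 with h | h | h
    · rw [pairWeight_of_sum_neg q x y h, pairWeight_of_sum_neg q x y (by lia),
        pairWeight_of_sum_neg q (x - 1) (y - 1) (by lia), pairWeight_of_sum_neg q (x - 1) y (by lia),
        pairWeight_of_sum_neg q x (y - 1) (by lia)]
      simp
    · rw [pairWeight_of_sum_neg q x y (L := L - 1) (by lia),
        pairWeight_of_sum_neg q (x - 1) (y - 1) (by lia), pairWeight_of_sum_neg q (x - 1) y (by lia),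
        pairWeight_of_sum_neg q x (y - 1) (by lia)]
      rcases lt_trichotomy (L + x) 0 with hx | hx | hx
      · simp [pairWeight, qPochInv_of_neg q hx]
      · rcases lt_trichotomy L 0 with hl | hl | hl
        · simp [pairWeight_of_neg q x y hl]
        · obtain rfl : x = 0 := by lia
          obtain rfl : y = 0 := by lia
          simp [hl]
        · simp [pairWeight, qPochInv_of_neg q (show L + (x + y) < 0 by lia)]
      · simp [pairWeight, qPochInv_of_neg q (show L + y < 0 by lia)]
    · have hs : 2 * L + (x + y) = 1 := by lia
      rw [pairWeight_of_sum_neg q x y (L := L - 1) (by lia),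
        pairWeight_of_sum_neg q (x - 1) (y - 1) (by lia)]
      have p1 : 2 * L + (x - 1 + y) = 0 := by lia
      have p2 : 2 * L + (x + (y - 1)) = 0 := by lia
      have p3 : qPoch q (1 : ℤ).toNat = 1 - q := by simp [qPoch]
      have p4 : qPoch q (0 : ℤ).toNat = 1 := by simp [qPoch]
      simp only [pairWeight, a5, a6, a7, a8, e2, e4, e5, hs, p1, p2, p3, p4, z2]
      rcases lt_or_ge (L + x) 0 with hx | hx
      · simp [qPochInv_of_neg q hx]
      rcases lt_or_ge (L + y) 0 with hy | hy
      · simp [qPochInv_of_neg q hy]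
      have hxy : (L + x = 0 ∧ L + y = 1) ∨ (L + x = 1 ∧ L + y = 0) := by lia
      have hz : q ^ L ≠ 0 := zpow_ne_zero _ hq0
      simp only [zpow_add₀ hq0]
      rcases hxy with ⟨h1, h2⟩ | ⟨h1, h2⟩
      · have g1 : q ^ x = (q ^ L)⁻¹ := by rw [← zpow_neg]; congr 1; lia
        have g2 : q ^ y = q * (q ^ L)⁻¹ := by
          rw [← zpow_neg, ← zpow_one_add₀ hq0]; congr 1; lia
        rw [g1, g2]
        field_simp
        ring
      · have g1 : q ^ x = q * (q ^ L)⁻¹ := by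
          rw [← zpow_neg, ← zpow_one_add₀ hq0]; congr 1; lia
        have g2 : q ^ y = (q ^ L)⁻¹ := by rw [← zpow_neg]; congr 1; lia
        rw [g1, g2]
        field_simp
        ring
  · have p1 := qPoch_toNat_of_pos q (show 0 < 2 * L + (x + y) by lia)
    have p2 := qPoch_toNat_of_pos q (show 0 < 2 * L + (x + y) - 1 by lia)
    have b1 : 2 * (L - 1) + (x + y) = 2 * L + (x + y) - 1 - 1 := by ring
    have b2 : 2 * L + (x - 1 + (y - 1)) = 2 * L + (x + y) - 1 - 1 := by ring
    have b3 : 2 * L + (x + (y - 1)) = 2 * L + (x + y) - 1 := by ring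
    have b4 : 2 * L + (x - 1 + y) = 2 * L + (x + y) - 1 := by ring
    have z3 : q ^ (2 * L + (x + y)) = (q ^ L) ^ 2 * q ^ x * q ^ y := by
      rw [zpow_add₀ hq0, zpow_add₀ hq0, mul_comm 2 L, zpow_mul]; norm_cast; ring
    have z4 : q ^ (2 * L + (x + y) - 1) = (q ^ L) ^ 2 * q ^ x * q ^ y * q⁻¹ := by
      rw [zpow_sub₀ hq0, z3, zpow_one]; rfl
    simp only [pairWeight, a1, a2, a3, a4, a5, a6, a7, a8, b1, b2, b3, b4, e1, e3, e2, e4, e5, p1, p2,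
      z1, z2, z3, z4]
    simp only [zpow_add₀ hq0]
    ring

/-- This applies the operator f(x-1) + q^x f(x) in both variables at once; the result telescopes
with partial sums `pairWeight`. -/
theorem pairSum_recursion (hq0 : q ≠ 0) (hq1 : ‖q‖ < 1) (x y : ℤ) :
    pairSum q (x - 1) (y - 1) + q ^ x * pairSum q x (y - 1) + q ^ y * pairSum q (x - 1) y
      + q ^ x * q ^ y * pairSum q x y = (qPochInf q)⁻¹ ^ 3 := by
  have s1 := summable_pairTerm hq1 (x - 1) (y - 1)
  have s2 := (summable_pairTerm hq1 x (y - 1)).mul_left (q ^ x)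
  have s3 := (summable_pairTerm hq1 (x - 1) y).mul_left (q ^ y)
  have s4 := (summable_pairTerm hq1 x y).mul_left (q ^ x * q ^ y)
  simp only [pairSum]
  rw [← tsum_mul_left, ← tsum_mul_left, ← tsum_mul_left, ← s1.tsum_add s2,
    ← (s1.add s2).tsum_add s3, ← ((s1.add s2).add s3).tsum_add s4]
  refine tsum_eq_of_sub_eq (W := pairWeight q x y) (((s1.add s2).add s3).add s4)
    (fun n hn => pairWeight_of_neg q x y hn) (fun n => ?_) ?_
  · rw [pairWeight_sub_one hq0 hq1]; ring
  · have h := qPochInf_ne_zero hq1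
    have := ((((tendsto_qPoch_toNat_add hq1 (x + y)).mul (tendsto_qPochInv_add hq1 0)).mul
      (tendsto_qPochInv_add hq1 (x + y))).mul (tendsto_qPochInv_add hq1 x)).mul
      (tendsto_qPochInv_add hq1 y)
    convert this using 2
    · simp [pairWeight]
    · field_simp

/-- Both sides have the same image (q)_∞⁻³ under the product of the operators f(x-1) + q^x f(x) and
f(y-1) + q^y f(y). Their difference is bounded, so the uniqueness principle removes first the
operator in y, then the one in x. -/
theorem pairSum_eq (hq0 : q ≠ 0) (hq1 : ‖q‖ < 1) (x y : ℤ) :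
    pairSum q x y = qPochInf q * chargeSum q x * chargeSum q y := by
  obtain ⟨C, hC, hS⟩ := exists_norm_pairSum_le hq1
  obtain ⟨D, hD, hE⟩ := exists_norm_chargeSum_le hq1
  have hne := qPochInf_ne_zero hq1
  have hbound : ∀ x y, ‖pairSum q x y - qPochInf q * chargeSum q x * chargeSum q y‖
      ≤ C + ‖qPochInf q‖ * D * D := fun x y => by
    refine (norm_sub_le _ _).trans ?_
    rw [norm_mul, norm_mul]
    gcongr <;> first | apply hS | apply hE
  have hqx : ∀ x : ℤ, 0 ≤ x → ‖q ^ x‖ ≤ 1 := fun x hx => by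
    lift x to ℕ using hx
    rw [zpow_natCast, norm_pow]; exact pow_le_one₀ (norm_nonneg _) hq1.le
  have hrec : ∀ x y,
      (pairSum q (x - 1) y - qPochInf q * chargeSum q (x - 1) * chargeSum q y)
        + q ^ x * (pairSum q x y - qPochInf q * chargeSum q x * chargeSum q y) = 0 := by
    intro x
    refine eq_zero_of_recursion hq1
      (C := (C + ‖qPochInf q‖ * D * D) + ‖q ^ x‖ * (C + ‖qPochInf q‖ * D * D)) (fun y _ => ?_)
      fun y => ?_
    · refine (norm_add_le _ _).trans ?_
      rw [norm_mul]
      gcongr <;> apply hbound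
    · have h1 := pairSum_recursion hq0 hq1 x y
      have h2 := chargeSum_sub_one_add hq0 hq1 x
      have h3 := chargeSum_sub_one_add hq0 hq1 y
      have h4 : qPochInf q * (chargeSum q (x - 1) + q ^ x * chargeSum q x)
          * (chargeSum q (y - 1) + q ^ y * chargeSum q y) = (qPochInf q)⁻¹ ^ 3 := by
        rw [h2, h3]; field_simp
      linear_combination h1 - h4
  refine sub_eq_zero.mp (eq_zero_of_recursion hq1
    (d := fun x => pairSum q x y - qPochInf q * chargeSum q x * chargeSum q y)
    (fun x _ => hbound x y) (fun x => ?_) x)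
  exact eq_neg_of_add_eq_zero_left (hrec x y)

/-- The summand of `∑ q ^ (d (d + m)) / ((q)_d (q)_(d+m))`. -/
noncomputable def durfeeTerm (q : ℂ) (m d : ℤ) : ℂ :=
  q ^ (d * (d + m)) * qPochInv q d * qPochInv q (d + m)

noncomputable def durfeeSum (q : ℂ) (m : ℤ) : ℂ := ∑' d, durfeeTerm q m d

theorem durfeeTerm_of_neg (q : ℂ) (m : ℤ) {d : ℤ} (h : d < 0) : durfeeTerm q m d = 0 := by
  simp [durfeeTerm, qPochInv_of_neg q h]

theorem durfeeTerm_of_add_neg (q : ℂ) (m : ℤ) {d : ℤ} (h : d + m < 0) : durfeeTerm q m d = 0 := by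
  simp [durfeeTerm, qPochInv_of_neg q h]

theorem exists_norm_durfeeTerm_le (hq0 : q ≠ 0) (hq1 : ‖q‖ < 1) :
    ∃ C : ℝ, 0 < C ∧ ∀ m d, ‖durfeeTerm q m d‖ ≤ C * ‖q‖ ^ (min m 0) * geomInd ‖q‖ d := by
  obtain ⟨C, hC, h⟩ := exists_norm_qPochInv_le hq1
  have hQ : 0 < ‖q‖ := norm_pos_iff.mpr hq0
  refine ⟨C * C, by positivity, fun m d => ?_⟩
  have hg := geomInd_nonneg hQ.le d
  rcases lt_or_ge d 0 with hd | hd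
  · rw [durfeeTerm_of_neg q m hd, norm_zero]; positivity
  rcases lt_or_ge (d + m) 0 with hm | hm
  · rw [durfeeTerm_of_add_neg q m hm, norm_zero]; positivity
  -- For negative m the exponent can fall below d (it is 0 at d = -m), whence the correction `min m
  -- 0`; it disappears for m ≥ 0, where uniformity in m is required.
  have hexp : min m 0 + d ≤ d * (d + m) := by
    rcases hd.eq_or_lt with rfl | hd
    · simp
    rcases hm.eq_or_lt with hm | hm
    · rw [← hm, mul_zero]; lia
    · have : d * 1 ≤ d * (d + m) := mul_le_mul_of_nonneg_left (by lia) hd.le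
      have := min_le_right m 0
      lia
  rw [geomInd, if_pos hd, durfeeTerm, norm_mul, norm_mul, norm_zpow, mul_assoc (C * C),
    ← zpow_add₀ hQ.ne']
  calc _ ≤ ‖q‖ ^ (min m 0 + d) * C * C := by
        gcongr ?_ * ?_ * ?_
        · exact zpow_le_zpow_right_of_le_one₀ hQ hq1.le hexp
        · apply h
        · apply h
    _ = _ := by ring

theorem summable_durfeeTerm (hq0 : q ≠ 0) (hq1 : ‖q‖ < 1) (m : ℤ) : Summable (durfeeTerm q m) := by
  obtain ⟨C, -, h⟩ := exists_norm_durfeeTerm_le hq0 hq1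
  exact summable_of_norm_le_geomInd (norm_nonneg _) hq1 (h m)

/-- The last summand is a difference of translates in d and sums to zero, leaving a homogeneous
recursion for consecutive differences of `durfeeSum`. -/
theorem durfeeTerm_sub (hq0 : q ≠ 0) (hq1 : ‖q‖ < 1) (m d : ℤ) :
    durfeeTerm q m d - durfeeTerm q (m + 1) d
      = -(q ^ (m + 1) * (durfeeTerm q (m + 1) d - durfeeTerm q (m + 2) d))
        + q ^ (m + 1) * (durfeeTerm q (m + 2) (d + -1) - durfeeTerm q (m + 2) d) := by
  have c1 : qPochInv q (d + -1) = (1 - q ^ d) * qPochInv q d := qPochInv_sub_one hq1 d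
  have c2 := qPochInv_sub_one hq1 (d + (m + 1))
  have b1 : d + m = d + (m + 1) - 1 := by ring
  have b2 : d + -1 + (m + 2) = d + (m + 1) := by ring
  have z1 : q ^ (d * (d + (m + 1))) = q ^ (d * (d + (m + 1) - 1)) * q ^ d := by
    rw [← zpow_add₀ hq0]; congr 1; ring
  have z2 : q ^ (d * (d + (m + 1) - 1)) = q ^ (m + 1) * q ^ ((d + -1) * (d + (m + 1))) := by
    rw [← zpow_add₀ hq0]; congr 1; ring
  have z3 : q ^ (d + (m + 1)) = q ^ d * q ^ (m + 1) := zpow_add₀ hq0 _ _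
  simp only [durfeeTerm, b1, b2, c1, c2, z3, z1, z2]
  generalize q ^ ((d + -1) * (d + (m + 1))) = Z
  generalize q ^ d = D
  generalize q ^ (m + 1) = M
  ring

theorem hasSum_durfeeTerm (hq0 : q ≠ 0) (hq1 : ‖q‖ < 1) (m : ℤ) :
    HasSum (durfeeTerm q m) (durfeeSum q m) :=
  (summable_durfeeTerm hq0 hq1 m).hasSum

theorem hasSum_comp_add {f : ℤ → ℂ} {a : ℂ} (hf : HasSum f a) (b : ℤ) :
    HasSum (fun d => f (d + b)) a :=
  ((Equiv.addRight b).hasSum_iff (f := f)).mpr hf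

theorem durfeeSum_recursion (hq0 : q ≠ 0) (hq1 : ‖q‖ < 1) (m : ℤ) :
    durfeeSum q m - durfeeSum q (m + 1)
      = -(q ^ (m + 1) * (durfeeSum q (m + 1) - durfeeSum q (m + 2))) := by
  have s0 := hasSum_durfeeTerm hq0 hq1 m
  have s1 := hasSum_durfeeTerm hq0 hq1 (m + 1)
  have s2 := hasSum_durfeeTerm hq0 hq1 (m + 2)
  have s3 := hasSum_comp_add s2 (-1)
  have h1 := ((s1.sub s2).mul_left (q ^ (m + 1))).neg.add ((s3.sub s2).mul_left (q ^ (m + 1)))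
  have h2 := (s0.sub s1).unique (by simpa only [← durfeeTerm_sub hq0 hq1 m] using h1)
  rwa [sub_self, mul_zero, add_zero] at h2

theorem tendsto_durfeeSum (hq0 : q ≠ 0) (hq1 : ‖q‖ < 1) :
    Tendsto (fun m : ℕ => durfeeSum q m) atTop (𝓝 (qPochInf q)⁻¹) := by
  obtain ⟨C, hC, h⟩ := exists_norm_durfeeTerm_le hq0 hq1
  have hlim : ∀ d : ℤ, Tendsto (fun m : ℕ => durfeeTerm q m d) atTop
      (𝓝 (if d = 0 then (qPochInf q)⁻¹ else 0)) := by
    intro d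
    rcases lt_trichotomy d 0 with hd | rfl | hd
    · simp [durfeeTerm_of_neg q _ hd, hd.ne]
    · simpa [durfeeTerm, qPochInv_zero] using tendsto_qPochInv_add hq1 0
    · rw [if_neg hd.ne']
      have h1 : Tendsto (fun m : ℕ => q ^ (d * d) * (q ^ d) ^ m) atTop (𝓝 0) := by
        have : ‖q ^ d‖ < 1 := by
          lift d to ℕ using hd.le
          rw [zpow_natCast, norm_pow]
          exact pow_lt_one₀ (norm_nonneg _) hq1 (by lia)
        simpa using (tendsto_pow_atTop_nhds_zero_of_norm_lt_one this).const_mul (q ^ (d * d))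
      have h2 := (h1.mul_const (qPochInv q d)).mul (tendsto_qPochInv_add hq1 d)
      simp only [zero_mul] at h2
      refine h2.congr fun m => ?_
      rw [durfeeTerm, mul_add, zpow_add₀ hq0, zpow_mul q d m, zpow_natCast, add_comm d]
  have := tendsto_tsum_of_dominated_convergence (𝓕 := atTop) (bound := fun d => C * geomInd ‖q‖ d)
    ((hasSum_geomInd (norm_nonneg q) hq1).summable.mul_left C) hlim
    (Eventually.of_forall fun m d => by simpa using h m d)
  simpa [tsum_ite_eq, durfeeSum] using this

/-- Consecutive differences obey the recursion of the uniqueness principle, so the sum is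
independent of m. Its value is read off as m → ∞, where only d = 0 survives. -/
theorem durfeeSum_eq (hq0 : q ≠ 0) (hq1 : ‖q‖ < 1) (m : ℤ) : durfeeSum q m = (qPochInf q)⁻¹ := by
  obtain ⟨C, hC, h⟩ := exists_norm_durfeeTerm_le hq0 hq1
  have hb : ∀ x : ℤ, 0 ≤ x → ‖durfeeSum q x‖ ≤ C * (1 - ‖q‖)⁻¹ := fun x hx =>
    norm_tsum_le_of_norm_le_geomInd (norm_nonneg _) hq1 fun d => by simpa [hx] using h x d
  have hstep : ∀ x, durfeeSum q x = durfeeSum q (x + 1) := fun x =>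
    sub_eq_zero.mp <| eq_zero_of_recursion hq1
      (d := fun x => durfeeSum q x - durfeeSum q (x + 1)) (C := C * (1 - ‖q‖)⁻¹ + C * (1 - ‖q‖)⁻¹)
      (fun x hx => (norm_sub_le _ _).trans (add_le_add (hb x hx) (hb _ (by lia))))
      (fun x => by
        have := durfeeSum_recursion hq0 hq1 (x - 1)
        rw [sub_add_cancel, show x - 1 + 2 = x + 1 by ring] at this
        simpa using this) x
  have hall : ∀ n : ℕ, durfeeSum q m = durfeeSum q (m + n) := by
    intro n
    induction n with
    | zero => simp
    | succ n ih => rw [ih, hstep, add_assoc]; push_cast; rfl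
  have h1 := (tendsto_add_atTop_iff_nat m.natAbs).mpr (tendsto_durfeeSum hq0 hq1)
  refine tendsto_nhds_unique (tendsto_const_nhds.congr' ?_) (tendsto_durfeeSum hq0 hq1)
  filter_upwards [eventually_ge_atTop m.natAbs] with n hn
  rw [hall (n - m).toNat]; congr 1; lia

end

/-! ### Convergence of Gaussian series and integrality of triangular exponents -/

section Gaussian

theorem summable_rpow_quadratic {Q : ℝ} (hQ : 0 < Q) (hQ1 : Q < 1) {α : ℝ} (hα : 0 < α)
    (β γ : ℝ) : Summable fun n : ℤ => Q ^ (α * n ^ 2 + β * n + γ) := by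
  have hlog : Real.log Q < 0 := Real.log_neg hQ hQ1
  -- The series is, up to a constant, the series of norms of a Jacobi theta function at purely
  -- imaginary arguments.
  set z : ℂ := ⟨0, -Real.log Q * β / (2 * Real.pi)⟩
  set w : ℂ := ⟨0, -Real.log Q * α / Real.pi⟩
  have hw : 0 < w.im := div_pos (mul_pos (neg_pos.mpr hlog) hα) Real.pi_pos
  refine (((summable_jacobiTheta₂_term_iff z w).mpr hw).norm.mul_left (Q ^ γ)).congr fun n => ?_
  rw [norm_jacobiTheta₂_term, Real.rpow_add hQ _ γ, mul_comm, Real.rpow_def_of_pos hQ (α * _ + _)]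
  congr 2
  have := Real.pi_ne_zero
  simp only [z, w]
  field_simp
  ring

theorem norm_zpow_eq_rpow (q : ℂ) (e : ℤ) : ‖q ^ e‖ = ‖q‖ ^ (e : ℝ) := by
  rw [norm_zpow, Real.rpow_intCast]

/-- The exact quotient `v (v - 1) / 2`. -/
def triExp (v : ℤ) : ℤ := v * (v - 1) / 2

theorem two_mul_triExp (v : ℤ) : 2 * triExp v = v * (v - 1) :=
  Int.mul_ediv_cancel' (Int.even_mul_pred_self v).two_dvd

theorem cast_triExp (v : ℤ) : (triExp v : ℝ) = v * (v - 1) / 2 := by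
  have h : (2 : ℝ) * triExp v = v * (v - 1) := by exact_mod_cast two_mul_triExp v
  linarith

theorem eq_of_two_mul_eq {a b : ℤ} (h : 2 * a = 2 * b) : a = b := by lia

end Gaussian

/-! ### Verma characters and their reflected differences -/

section Verma

variable {q : ℂ}

theorem summable_norm_zpow_triExp (hq0 : q ≠ 0) (hq1 : ‖q‖ < 1) (T b c : ℤ) :
    Summable fun a : ℤ => ‖q ^ (triExp (2 * a - T) + b * a + c)‖ := by
  have hQ : 0 < ‖q‖ := norm_pos_iff.mpr hq0
  refine (summable_rpow_quadratic hQ hq1 (α := 2) two_pos (-2 * T - 1 + b)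
    (T * (T + 1) / 2 + c)).congr fun a => ?_
  rw [norm_zpow_eq_rpow]
  congr 1
  push_cast [cast_triExp]
  ring

theorem summable_zpow_triExp_mul (hq0 : q ≠ 0) (hq1 : ‖q‖ < 1) (T b c : ℤ) {f : ℤ → ℂ} {C : ℝ}
    (hf : ∀ a, ‖f a‖ ≤ C) : Summable fun a : ℤ => q ^ (triExp (2 * a - T) + b * a + c) * f a := by
  refine Summable.of_norm_bounded ((summable_norm_zpow_triExp hq0 hq1 T b c).mul_right C) fun a => ?_
  rw [norm_mul]
  exact mul_le_mul_of_nonneg_left (hf a) (norm_nonneg _)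

/-- The summand of the Verma character, indexed by the charge and the smaller summation
variable. -/
noncomputable def shearedVermaTerm (t : ℤ) (q : ℂ) (p : ℤ × ℤ) : ℂ :=
  q ^ (triExp (2 * p.1 - t) + p.1) * chargeTerm q p.1 p.2

theorem summable_shearedVermaTerm (hq0 : q ≠ 0) (hq1 : ‖q‖ < 1) (t : ℤ) :
    Summable (shearedVermaTerm t q) := by
  obtain ⟨C, hC, h⟩ := exists_norm_chargeTerm_le hq1
  have h1 : Summable fun a : ℤ => ‖q ^ (triExp (2 * a - t) + a)‖ := by
    simpa using summable_norm_zpow_triExp hq0 hq1 t 1 0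
  have h2 := (hasSum_geomInd (norm_nonneg q) hq1).summable.mul_left C
  refine Summable.of_norm_bounded (h1.mul_of_nonneg h2 (fun _ => norm_nonneg _) fun k =>
    mul_nonneg hC.le (geomInd_nonneg (norm_nonneg _) k)) fun p => ?_
  rw [shearedVermaTerm, norm_mul]
  exact mul_le_mul_of_nonneg_left (h _ _) (norm_nonneg _)

/-- The embedding `(i, j) ↦ (j - i, i)`. -/
def chargeEmb (p : ℕ × ℕ) : ℤ × ℤ := ((p.2 : ℤ) - p.1, p.1)

theorem chargeEmb_injective : Function.Injective chargeEmb := by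
  rintro ⟨i, j⟩ ⟨i', j'⟩ h
  simp only [chargeEmb, Prod.mk.injEq] at h ⊢
  lia

theorem shearedVermaTerm_comp_chargeEmb (hq0 : q ≠ 0) (t : ℤ) :
    shearedVermaTerm t q ∘ chargeEmb = vermaTerm t q := by
  funext ⟨i, j⟩
  simp only [Function.comp, chargeEmb, shearedVermaTerm, chargeTerm, vermaTerm, add_sub_cancel,
    qPochInv_natCast]
  rw [mul_assoc (q ^ (i : ℤ)), ← mul_assoc, ← zpow_add₀ hq0, div_eq_mul_inv, mul_inv,
    show triExp (2 * ((j : ℤ) - i) - t) + (j - i) + i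
      = (2 * (j : ℤ) - 2 * i - t) * (2 * j - 2 * i - t - 1) / 2 + j by
      rw [triExp, mul_sub 2, add_assoc, sub_add_cancel]]

theorem shearedVermaTerm_eq_zero (t : ℤ) (p : ℤ × ℤ) (hp : p ∉ Set.range chargeEmb) :
    shearedVermaTerm t q p = 0 := by
  obtain ⟨a, k⟩ := p
  rcases lt_or_ge k 0 with hk | hk
  · simp [shearedVermaTerm, chargeTerm, qPochInv_of_neg q hk]
  rcases lt_or_ge (k + a) 0 with ha | ha
  · simp [shearedVermaTerm, chargeTerm, qPochInv_of_neg q ha]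
  · exact absurd ⟨(k.toNat, (k + a).toNat), by simp [chargeEmb, hk, ha]⟩ hp

theorem summable_vermaTerm (hq0 : q ≠ 0) (hq1 : ‖q‖ < 1) (t : ℤ) : Summable (vermaTerm t q) := by
  rw [← shearedVermaTerm_comp_chargeEmb hq0]
  exact (chargeEmb_injective.summable_iff (shearedVermaTerm_eq_zero t)).mpr
    (summable_shearedVermaTerm hq0 hq1 t)

theorem verma_eq (hq0 : q ≠ 0) (hq1 : ‖q‖ < 1) (t : ℤ) :
    verma t q = (qPochInf q)⁻¹ * ∑' a : ℤ, q ^ (triExp (2 * a - t) + a) * chargeSum q a := by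
  have h1 := (chargeEmb_injective.hasSum_iff (shearedVermaTerm_eq_zero t)).mpr
    (summable_shearedVermaTerm hq0 hq1 t).hasSum
  rw [shearedVermaTerm_comp_chargeEmb hq0] at h1
  rw [verma, h1.tsum_eq]
  congr 1
  have h2 : ∀ a, HasSum (fun k => shearedVermaTerm t q (a, k))
      (q ^ (triExp (2 * a - t) + a) * chargeSum q a) := fun a => by
    simp only [shearedVermaTerm]
    exact (hasSum_chargeTerm hq1 a).mul_left (q ^ (triExp (2 * a - t) + a))
  exact ((summable_shearedVermaTerm hq0 hq1 t).hasSum.prod_fiberwise h2).tsum_eq.symm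

/-- The summand of the truncated Verma character of relative charge `t`. -/
noncomputable def truncTerm (q : ℂ) (r t a : ℤ) : ℂ :=
  q ^ (triExp (2 * a - t) + a) * (chargeSum q a * chargeSum q (r - a))

/-- One factor (q)_∞⁻¹ is replaced by (q)_∞ (E(r-a) + q^{r+1-a} E(r+1-a)), with E = `chargeSum`. The
second part has the symmetric product E(a) E(r+1-a), and a ↦ r+1-a turns t into 2r+1-t there, so it
cancels. -/
theorem verma_sub_verma (hq0 : q ≠ 0) (hq1 : ‖q‖ < 1) (r t : ℤ) :
    verma t q - verma (2 * r + 1 - t) q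
      = qPochInf q * (∑' a, truncTerm q r t a - ∑' a, truncTerm q r (2 * r + 1 - t) a) := by
  have hne := qPochInf_ne_zero hq1
  obtain ⟨C, hC, hE⟩ := exists_norm_chargeSum_le hq1
  have hEE : ∀ x y, ‖chargeSum q x * chargeSum q y‖ ≤ C * C := fun x y => by
    rw [norm_mul]; gcongr <;> apply hE
  set J : ℤ → ℂ := fun t =>
    ∑' a, q ^ (triExp (2 * a - t) + (r + 1)) * (chargeSum q a * chargeSum q (r + 1 - a)) with hJ
  have hJsymm : J (2 * r + 1 - t) = J t := by
    simp only [hJ]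
    rw [← (Equiv.subLeft (r + 1)).tsum_eq]
    refine tsum_congr fun a => ?_
    simp only [Equiv.subLeft_apply, sub_sub_cancel]
    rw [mul_comm (chargeSum q (r + 1 - a))]
    congr 3
    apply eq_of_two_mul_eq
    rw [two_mul_triExp, two_mul_triExp]
    ring
  have hV : ∀ t, verma t q = qPochInf q * (∑' a, truncTerm q r t a + J t) := by
    intro t
    have s1 : Summable fun a => truncTerm q r t a := by
      simpa [truncTerm] using summable_zpow_triExp_mul hq0 hq1 t 1 0
        (f := fun a => chargeSum q a * chargeSum q (r - a)) (fun a => hEE a (r - a))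
    have s2 : Summable fun a => q ^ (triExp (2 * a - t) + (r + 1))
        * (chargeSum q a * chargeSum q (r + 1 - a)) := by
      simpa using summable_zpow_triExp_mul hq0 hq1 t 0 (r + 1)
        (f := fun a => chargeSum q a * chargeSum q (r + 1 - a)) (fun a => hEE a (r + 1 - a))
    rw [hJ, ← s1.tsum_add s2, verma_eq hq0 hq1, ← tsum_mul_left, ← tsum_mul_left]
    refine tsum_congr fun a => ?_
    have h1 := chargeSum_sub_one_add hq0 hq1 (r + 1 - a)
    rw [show r + 1 - a - 1 = r - a by ring] at h1
    have h2 : q ^ (triExp (2 * a - t) + (r + 1))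
        = q ^ (triExp (2 * a - t) + a) * q ^ (r + 1 - a) := by
      rw [← zpow_add₀ hq0]; congr 1; ring
    rw [truncTerm, h2]
    have h3 : (qPochInf q)⁻¹ = qPochInf q * (qPochInf q)⁻¹ ^ 2 := by field_simp
    rw [h3, ← h1]
    ring
  rw [hV, hV, hJsymm]
  ring

end Verma

/-! ### Gaussian binomials, including inversion of the base -/

section Binomial

variable {q : ℂ}

theorem qBinom_eq (q : ℂ) (n m : ℤ) :
    qBinom q n m = qPoch q n.toNat * qPochInv q m * qPochInv q (n - m) := by
  unfold qBinom
  split_ifs with h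
  · rw [qPochInv, qPochInv, if_pos h.1, if_pos (by lia), div_eq_mul_inv, mul_inv, mul_assoc]
  · rcases lt_or_ge m 0 with hm | hm
    · simp [qPochInv_of_neg q hm]
    · simp [qPochInv_of_neg q (show n - m < 0 by lia)]

theorem qPoch_inv (hq0 : q ≠ 0) (n : ℕ) :
    qPoch q⁻¹ n = (∏ i ∈ Finset.range n, -q⁻¹ ^ (i + 1)) * qPoch q n := by
  rw [qPoch, qPoch, ← Finset.prod_mul_distrib]
  refine Finset.prod_congr rfl fun i _ => ?_
  rw [inv_pow]
  field_simp
  ring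

theorem prod_neg_inv_pow_add (q : ℂ) (a b : ℕ) :
    ∏ i ∈ Finset.range (a + b), -q⁻¹ ^ (i + 1)
      = (∏ i ∈ Finset.range a, -q⁻¹ ^ (i + 1)) * (∏ i ∈ Finset.range b, -q⁻¹ ^ (i + 1))
        * q⁻¹ ^ (a * b) := by
  have : ∀ i, -q⁻¹ ^ (a + i + 1) = -q⁻¹ ^ (i + 1) * q⁻¹ ^ a := fun i => by ring
  rw [Finset.prod_range_add, Finset.prod_congr rfl fun i _ => this i, Finset.prod_mul_distrib,
    Finset.prod_const, Finset.card_range, ← pow_mul]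
  ring

theorem qBinom_inv (hq0 : q ≠ 0) (hq1 : ‖q‖ < 1) (n m : ℤ) :
    qBinom q⁻¹ n m = q ^ (-(m * (n - m))) * qBinom q n m := by
  unfold qBinom
  split_ifs with h
  · obtain ⟨a, rfl⟩ : ∃ a : ℕ, m = a := ⟨m.toNat, by lia⟩
    obtain ⟨b, rfl⟩ : ∃ b : ℕ, n = (a + b : ℕ) := ⟨(n - a).toNat, by lia⟩
    have e : ((a + b : ℕ) : ℤ) - a = b := by push_cast; ring
    have hT : ∀ n : ℕ, ∏ i ∈ Finset.range n, -q⁻¹ ^ (i + 1) ≠ 0 := fun n =>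
      Finset.prod_ne_zero_iff.mpr fun i _ => neg_ne_zero.mpr (pow_ne_zero _ (inv_ne_zero hq0))
    have hz : q ^ (-((a : ℤ) * b)) = q⁻¹ ^ (a * b) := by
      rw [zpow_neg, inv_pow]; norm_cast
    simp only [e, Int.toNat_natCast, hz, qPoch_inv hq0]
    rw [prod_neg_inv_pow_add]
    have h1 := hT a
    have h2 := hT b
    have h3 := qPoch_ne_zero hq1 a
    have h4 := qPoch_ne_zero hq1 b
    generalize ∏ i ∈ Finset.range a, -q⁻¹ ^ (i + 1) = A at *
    generalize ∏ i ∈ Finset.range b, -q⁻¹ ^ (i + 1) = B at *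
    generalize q⁻¹ ^ (a * b) = Z
    field_simp
  · simp

theorem finite_support_qBinom (q : ℂ) {P : ℤ} (hP : 0 < P) (n c : ℤ) :
    (Function.support fun j : ℤ => qBinom q n (c - P * j)).Finite := by
  have hinj : Set.InjOn (fun j : ℤ => c - P * j) ((fun j : ℤ => c - P * j) ⁻¹' Set.Icc 0 n) :=
    fun a _ b _ h => mul_left_cancel₀ hP.ne' (by simpa using h)
  refine ((Set.finite_Icc (0 : ℤ) n).preimage hinj).subset fun j hj => ?_
  by_contra h
  refine hj ?_
  simp only [Set.mem_preimage, Set.mem_Icc] at h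
  exact if_neg h

end Binomial

/-! ### Affine Weyl symmetry of configuration sums and folding into the alcove -/

section ConfigSum

variable {q : ℂ}

/-- The first half of the configuration sum with `p = r = 1`. -/
noncomputable def configHalf (P s L b : ℤ) (q : ℂ) : ℂ :=
  ∑' j : ℤ, q ^ (j * (P * j + P - s)) * qBinom q L ((L + s - b) / 2 - P * j)

theorem summable_configHalf {P : ℤ} (hP : 0 < P) (s L b : ℤ) (q : ℂ) :
    Summable fun j : ℤ => q ^ (j * (P * j + P - s)) * qBinom q L ((L + s - b) / 2 - P * j) :=
  summable_of_hasFiniteSupport ((finite_support_qBinom q hP L _).subset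
    (Function.support_mul_subset_right _ _))

theorem configSum_eq (hq0 : q ≠ 0) {P : ℤ} (hP : 0 < P) (s L b : ℤ) :
    configSum 1 P 1 s L b q = configHalf P s L b q - q ^ s * configHalf P (-s) L b q := by
  rw [configHalf, configHalf, ← tsum_mul_left,
    ← (summable_configHalf hP s L b q).tsum_sub ((summable_configHalf hP (-s) L b q).mul_left _)]
  refine tsum_congr fun j => ?_
  rw [configTerm, ← mul_assoc, ← zpow_add₀ hq0, ← sub_eq_add_neg L s]
  congr 3 <;> ring_nf

theorem configHalf_sub (hq0 : q ≠ 0) (P s L b t : ℤ) :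
    configHalf P (s - 2 * P * t) L b q = q ^ (-(t * (P * t + P - s))) * configHalf P s L b q := by
  rw [configHalf, configHalf, ← tsum_mul_left, ← (Equiv.subRight t).tsum_eq]
  refine tsum_congr fun j => ?_
  rw [← mul_assoc, ← zpow_add₀ hq0, Equiv.subRight_apply,
    show L + (s - 2 * P * t) - b = L + s - b + (-(P * t)) * 2 by ring,
    Int.add_mul_ediv_right _ _ two_ne_zero]
  congr 2 <;> ring

theorem configSum_sub (hq0 : q ≠ 0) {P : ℤ} (hP : 0 < P) (s L b t : ℤ) :
    configSum 1 P 1 (s - 2 * P * t) L b q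
      = q ^ (-(t * (P * t + P - s))) * configSum 1 P 1 s L b q := by
  rw [configSum_eq hq0 hP, configSum_eq hq0 hP, configHalf_sub hq0,
    show -(s - 2 * P * t) = -s - 2 * P * (-t) by ring, configHalf_sub hq0]
  have e : q ^ (s - 2 * P * t) * q ^ (-(-t * (P * -t + P - -s)))
      = q ^ (-(t * (P * t + P - s))) * q ^ s := by
    rw [← zpow_add₀ hq0, ← zpow_add₀ hq0]; congr 1; ring
  linear_combination (-configHalf P (-s) L b q) * e

theorem configSum_neg (hq0 : q ≠ 0) {P : ℤ} (hP : 0 < P) (s L b : ℤ) :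
    configSum 1 P 1 (-s) L b q = -(q ^ (-s) * configSum 1 P 1 s L b q) := by
  rw [configSum_eq hq0 hP, configSum_eq hq0 hP, neg_neg, mul_sub, ← mul_assoc, ← zpow_add₀ hq0,
    neg_add_cancel, zpow_zero]
  ring

theorem configSum_two_mul (hq0 : q ≠ 0) {P : ℤ} (hP : 0 < P) (L b t : ℤ) :
    configSum 1 P 1 (2 * P * t) L b q = 0 := by
  have h0 : configSum 1 P 1 0 L b q = 0 := by
    have := configSum_neg hq0 hP 0 L b
    simp only [neg_zero, zpow_zero, one_mul] at this
    exact self_eq_neg.mp this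
  rw [show 2 * P * t = 0 - 2 * P * (-t) by ring, configSum_sub hq0 hP, h0, mul_zero]

/-- At s = P the reflection s ↦ -s and the translation by -2P lead to the same point with opposite
signs. -/
theorem configSum_add_two_mul (hq0 : q ≠ 0) {P : ℤ} (hP : 0 < P) (L b t : ℤ) :
    configSum 1 P 1 (P + 2 * P * t) L b q = 0 := by
  have h0 : configSum 1 P 1 P L b q = 0 := by
    have h1 := configSum_neg hq0 hP P L b
    have h2 := configSum_sub hq0 hP P L b 1
    rw [show P - 2 * P * 1 = -P by ring, h1, show -(1 * (P * 1 + P - P)) = -P by ring] at h2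
    exact (mul_eq_zero.mp (self_eq_neg.mp h2.symm)).resolve_left (zpow_ne_zero _ hq0)
  rw [show P + 2 * P * t = P - 2 * P * (-t) by ring, configSum_sub hq0 hP, h0, mul_zero]

/-- A sum over the integers that vanishes on the walls of the affine Weyl group, folded into the
fundamental alcove. -/
theorem tsum_eq_sum_alcove (k : ℕ) {h : ℤ → ℂ} (hs : Summable h)
    (h0 : ∀ j : ℤ, h (2 * (k + 2) * j) = 0) (hP : ∀ j : ℤ, h (k + 2 + 2 * (k + 2) * j) = 0) :
    ∑' s, h s = ∑ i ∈ Finset.range (k + 1),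
      (∑' j : ℤ, h (i + 1 - 2 * (k + 2) * j) + ∑' j : ℤ, h (-(i + 1) - 2 * (k + 2) * j)) := by
  set M : ℤ → ℂ := fun s => ∑' j : ℤ, h (s + 2 * (k + 2) * j) with hM
  have hMneg : ∀ s, ∑' j : ℤ, h (s - 2 * (k + 2) * j) = M s := fun s => by
    rw [hM, ← (Equiv.neg ℤ).tsum_eq]
    refine tsum_congr fun j => ?_
    rw [Equiv.neg_apply]; congr 1; ring
  have hMper : ∀ s, M (s + 2 * (k + 2)) = M s := fun s => by
    simp only [hM]
    rw [← (Equiv.addRight (1 : ℤ)).tsum_eq fun j => h (s + 2 * (k + 2) * j)]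
    refine tsum_congr fun j => ?_
    rw [Equiv.coe_addRight]; congr 1; ring
  have hM0 : M 0 = 0 := by simp [hM, h0]
  have hMP : M (k + 2) = 0 := by simp [hM, hP]
  have h1 : ∑' s, h s = ∑ i ∈ Finset.range (2 * (k + 2)), M i := by
    let e : Fin (2 * (k + 2)) × ℤ ≃ ℤ :=
      (Equiv.prodComm _ _).trans (Int.divModEquiv (2 * (k + 2))).symm
    have he : ∀ p, h (e p) = h (p.1 + 2 * (k + 2) * p.2) := fun p => by
      simp only [e, Equiv.trans_apply, Equiv.prodComm_apply, Int.divModEquiv_symm_apply,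
        Prod.fst_swap, Prod.snd_swap]
      congr 1; push_cast; ring
    have hs' : Summable fun p : Fin (2 * (k + 2)) × ℤ => h (p.1 + 2 * (k + 2) * p.2) :=
      (e.summable_iff.mpr hs).congr he
    rw [← e.tsum_eq h, tsum_congr he, hs'.tsum_prod, tsum_fintype, Finset.sum_range]
  -- The upper half of a period, translated down by 2(k+2), is the mirror image of the alcove.
  have h2 : ∀ i : ℕ, i < k + 1 → M ((k + 2 + (i + 1) : ℕ) : ℤ) = M (-((k - i : ℕ) + 1)) := by
    intro i hi
    rw [← hMper (-_)]
    congr 1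
    push_cast [Nat.sub_eq_iff_eq_add, Nat.cast_sub (show i ≤ k by lia)]
    ring
  rw [h1, two_mul, Finset.sum_range_add, Finset.sum_range_succ' _ (k + 1),
    Finset.sum_range_succ' _ (k + 1)]
  have hMP' : M ((k + 2 + 0 : ℕ) : ℤ) = 0 := by simpa using hMP
  rw [hMP', Nat.cast_zero, hM0, add_zero, add_zero,
    Finset.sum_congr rfl fun i hi => h2 i (Finset.mem_range.mp hi), Finset.sum_add_distrib]
  congr 1
  · exact Finset.sum_congr rfl fun i _ => by rw [hMneg]; push_cast; rfl
  · rw [← Finset.sum_range_reflect]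
    refine Finset.sum_congr rfl fun i hi => ?_
    rw [hMneg]
    congr 4
    have := Finset.mem_range.mp hi
    lia

/-- The product of two configuration sums with inverse bases, summed over the fundamental
alcove. -/
theorem sum_configSum_mul_configSum (hq0 : q ≠ 0) (k : ℕ) (ℓ r n L b : ℤ) :
    ∑ i ∈ (Finset.range (k + 1)).filter (fun i : ℕ => (i : ℤ) ≡ r [ZMOD 2]),
        configSum 1 (k + 2) 1 (i + 1) n (ℓ + 1) q⁻¹ * configSum 1 (k + 2) 1 (i + 1) L b q
      = ∑' u : ℤ, qBinom q⁻¹ n ((n + (r + 1 - 2 * u) - (ℓ + 1)) / 2)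
          * configSum 1 (k + 2) 1 (r + 1 - 2 * u) L b q := by
  have hP : (0 : ℤ) < k + 2 := by positivity
  set g : ℤ → ℂ := fun s => qBinom q⁻¹ n ((n + s - (ℓ + 1)) / 2) with hg
  set X : ℤ → ℂ := fun s => configSum 1 (k + 2) 1 s L b q with hX
  set h : ℤ → ℂ := fun s => if s ≡ r + 1 [ZMOD 2] then g s * X s else 0 with hh
  -- The powers of q⁻¹ in `configHalf` are exactly the factors that X acquires under s ↦ s -
  -- 2(k+2)j, so they are absorbed.
  have hhalf : ∀ s, configHalf (k + 2) s n (ℓ + 1) q⁻¹ * X s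
      = ∑' j : ℤ, g (s - 2 * (k + 2) * j) * X (s - 2 * (k + 2) * j) := fun s => by
    rw [configHalf, ← tsum_mul_right]
    refine tsum_congr fun j => ?_
    simp only [hX, hg]
    rw [configSum_sub hq0 hP, inv_zpow, ← zpow_neg,
      show n + (s - 2 * (k + 2) * j) - (ℓ + 1) = n + s - (ℓ + 1) + (-((k + 2) * j)) * 2 by ring,
      Int.add_mul_ediv_right _ _ two_ne_zero, ← sub_eq_add_neg]
    ring
  have hpar : ∀ s j : ℤ, (s - 2 * (k + 2) * j ≡ r + 1 [ZMOD 2]) ↔ s ≡ r + 1 [ZMOD 2] := by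
    intro s j
    have : s - 2 * (k + 2) * j ≡ s [ZMOD 2] :=
      Int.modEq_iff_dvd.mpr ⟨(k + 2) * j, by ring⟩
    exact ⟨this.symm.trans, this.trans⟩
  have hsum : ∀ s, ∑' j : ℤ, h (s - 2 * (k + 2) * j)
      = if s ≡ r + 1 [ZMOD 2] then configHalf (k + 2) s n (ℓ + 1) q⁻¹ * X s else 0 := by
    intro s
    simp only [hh, hpar]
    split_ifs
    · rw [hhalf]
    · simp
  have hsupp : ∀ u : ℤ, h (r + 1 - 2 * u) = g (r + 1 - 2 * u) * X (r + 1 - 2 * u) := fun u => by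
    simp only [hh]
    rw [if_pos (Int.modEq_iff_dvd.mpr ⟨u, by ring⟩)]
  have hinj : Function.Injective fun u : ℤ => r + 1 - 2 * u := fun a b hab => by
    dsimp only at hab; lia
  have hrange : ∀ s ∉ Set.range (fun u : ℤ => r + 1 - 2 * u), h s = 0 := fun s hs => by
    simp only [hh]
    refine if_neg fun hmod => hs ?_
    obtain ⟨c, hc⟩ := Int.modEq_iff_dvd.mp hmod
    exact ⟨c, by dsimp only; lia⟩
  have hfin : Summable fun u : ℤ => h (r + 1 - 2 * u) := by
    refine summable_of_hasFiniteSupport (((finite_support_qBinom q⁻¹ one_pos n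
      ((n + r - ℓ) / 2)).subset fun u hu => ?_))
    have : (n + (r + 1 - 2 * u) - (ℓ + 1)) / 2 = (n + r - ℓ) / 2 - 1 * u := by lia
    simp only [Function.mem_support, hsupp, hg, this] at hu ⊢
    exact left_ne_zero_of_mul hu
  have hs : Summable h := (hinj.summable_iff hrange).mp hfin
  have htsum : ∑' u : ℤ, h (r + 1 - 2 * u) = ∑' s, h s :=
    ((hinj.hasSum_iff hrange).mpr hs.hasSum).tsum_eq
  rw [← tsum_congr hsupp, htsum, tsum_eq_sum_alcove k hs, Finset.sum_filter]
  · refine Finset.sum_congr rfl fun i _ => ?_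
    rw [hsum, hsum]
    have p1 : ((i : ℤ) + 1 ≡ r + 1 [ZMOD 2]) ↔ (i : ℤ) ≡ r [ZMOD 2] := by
      simp only [Int.ModEq]; lia
    have p2 : (-((i : ℤ) + 1) ≡ r + 1 [ZMOD 2]) ↔ (i : ℤ) ≡ r [ZMOD 2] := by
      simp only [Int.ModEq]; lia
    simp only [p1, p2]
    split_ifs
    · simp only [hX]
      rw [configSum_neg hq0 hP, configSum_eq (inv_ne_zero hq0) hP, inv_zpow, ← zpow_neg]
      ring
    · simp
  · intro j
    simp only [hh, hX, configSum_two_mul hq0 hP, mul_zero, ite_self]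
  · intro j
    simp only [hh, hX, configSum_add_two_mul hq0 hP, mul_zero, ite_self]

end ConfigSum

/-! ### The fourfold series and its summation to the bosonic side -/

section Kernel

variable {q : ℂ}

/-- The summand of the fourfold sum, at `((d, L), (u, j))`. The two halves of the configuration
sums correspond to `σ = 0` and to `σ = - k - 1`. -/
noncomputable def kernelTerm (k ℓ : ℕ) (r σ : ℤ) (q : ℂ) (p : (ℤ × ℤ) × (ℤ × ℤ)) : ℂ :=
  durfeeTerm q (2 * p.2.1 + ℓ - r) p.1.1
    * (q ^ p.1.2 * pairWeight q (r - (p.2.1 + (k + 2) * p.2.2 - σ))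
        (p.2.1 + (k + 2) * p.2.2 - σ) p.1.2)
    * q ^ (triExp (2 * p.2.1 + ℓ - r) + p.2.1
        + p.2.2 * ((k + 2) * p.2.2 + (k + 2) - (r + 1 - 2 * p.2.1)))

/-- The change of variables `d = w - u`. -/
def shearCharge : (ℤ × ℤ) × (ℤ × ℤ) ≃ (ℤ × ℤ) × (ℤ × ℤ) where
  toFun p := ((p.1.1 - p.2.1, p.1.2), p.2)
  invFun p := ((p.1.1 + p.2.1, p.1.2), p.2)
  left_inv p := by simp
  right_inv p := by simp

/-- The change of variables `u = v - j`. -/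
def shearIndex : (ℤ × ℤ) × (ℤ × ℤ) ≃ (ℤ × ℤ) × (ℤ × ℤ) where
  toFun p := (p.1, (p.2.1 - p.2.2, p.2.2))
  invFun p := (p.1, (p.2.1 + p.2.2, p.2.2))
  left_inv p := by simp
  right_inv p := by simp

/-- With w = d + u and v = u + j the quadratic part of the exponent becomes w² + v² + (k+1)j², and
the linear part separates too, so a product of three Gaussian series and a geometric one in L
dominates. -/
theorem summable_kernelTerm (hq0 : q ≠ 0) (hq1 : ‖q‖ < 1) (k ℓ : ℕ) (r σ : ℤ) :
    Summable (kernelTerm k ℓ r σ q) := by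
  have hQ : 0 < ‖q‖ := norm_pos_iff.mpr hq0
  obtain ⟨C, hC, hc⟩ := exists_norm_qPochInv_le hq1
  obtain ⟨D, hD, hp⟩ := exists_norm_pairTerm_le hq1
  set δ : ℝ := ℓ - r with hδ
  set g₁ : ℤ → ℝ := fun w => ‖q‖ ^ (1 * (w : ℝ) ^ 2 + δ * w + δ ^ 2 / 4) with hg₁
  set g₂ : ℤ → ℝ := fun j => ‖q‖ ^ ((k + 1 : ℝ) * (j : ℝ) ^ 2 + (k + 1 - ℓ) * j + (-δ / 2)) with hg₂
  have s₁ : Summable g₁ := summable_rpow_quadratic hQ hq1 one_pos _ _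
  have s₂ : Summable g₂ := summable_rpow_quadratic hQ hq1 (by positivity) _ _
  have s₃ := (hasSum_geomInd hQ.le hq1).summable
  have n₁ : ∀ w, 0 ≤ g₁ w := fun w => by positivity
  have n₂ : ∀ w, 0 ≤ g₂ w := fun w => by positivity
  have n₃ := geomInd_nonneg hQ.le
  have hbound : Summable fun p : (ℤ × ℤ) × (ℤ × ℤ) =>
      (g₁ p.1.1 * geomInd ‖q‖ p.1.2) * (g₁ p.2.1 * g₂ p.2.2) :=
    (s₁.mul_of_nonneg s₃ n₁ n₃).mul_of_nonneg (s₁.mul_of_nonneg s₂ n₁ n₂)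
      (fun p => mul_nonneg (n₁ _) (n₃ _)) fun p => mul_nonneg (n₁ _) (n₂ _)
  refine ((shearIndex.trans shearCharge).summable_iff).mp
    (Summable.of_norm_bounded (hbound.mul_left (C * C * D)) ?_)
  rintro ⟨⟨w, L⟩, v, j⟩
  simp only [Function.comp, Equiv.trans_apply, shearIndex, shearCharge, Equiv.coe_fn_mk, kernelTerm,
    durfeeTerm, norm_mul _ (q ^ (triExp _ + _ + _)), norm_mul _ (_ * pairWeight _ _ _ _),
    norm_mul _ (qPochInv _ _)]
  set e₁ : ℤ := (w - (v - j)) * (w - (v - j) + (2 * (v - j) + ℓ - r))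
  set e₂ : ℤ := triExp (2 * (v - j) + ℓ - r) + (v - j)
    + j * ((k + 2) * j + (k + 2) - (r + 1 - 2 * (v - j)))
  have hexp : ‖q ^ e₁‖ * ‖q ^ e₂‖ = g₁ w * g₁ v * g₂ j := by
    simp only [norm_zpow_eq_rpow, hg₁, hg₂, ← Real.rpow_add hQ]
    congr 1
    simp only [e₁, e₂]
    push_cast [cast_triExp]
    rw [hδ]
    ring
  calc _ ≤ ‖q ^ e₁‖ * C * C * (D * geomInd ‖q‖ L) * ‖q ^ e₂‖ := by
        gcongr
        · apply hc
        · apply hc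
        · apply hp
    _ = C * C * D * geomInd ‖q‖ L * (‖q ^ e₁‖ * ‖q ^ e₂‖) := by ring
    _ = _ := by rw [hexp]; ring

/-- The kernel summed over `(d, L)`. -/
noncomputable def kernelFiber (k ℓ : ℕ) (r σ : ℤ) (q : ℂ) (p : ℤ × ℤ) : ℂ :=
  q ^ (triExp (2 * p.1 + ℓ - r) + p.1 + p.2 * ((k + 2) * p.2 + (k + 2) - (r + 1 - 2 * p.1)))
    * (chargeSum q (p.1 + (k + 2) * p.2 - σ) * chargeSum q (r - (p.1 + (k + 2) * p.2 - σ)))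

theorem hasSum_int_mul_int {f g : ℤ → ℂ} {a b : ℂ} (hf : HasSum f a) (hg : HasSum g b) :
    HasSum (fun p : ℤ × ℤ => f p.1 * g p.2) (a * b) :=
  hf.mul hg (summable_mul_of_summable_norm hf.summable.norm hg.summable.norm)

/-- The Durfee sum contributes (q)_∞⁻¹, which cancels the factor (q)_∞ of `pairSum_eq`. -/
theorem hasSum_kernelTerm_fiber (hq0 : q ≠ 0) (hq1 : ‖q‖ < 1) (k ℓ : ℕ) (r σ : ℤ) (p : ℤ × ℤ) :
    HasSum (fun x => kernelTerm k ℓ r σ q (x, p)) (kernelFiber k ℓ r σ q p) := by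
  simp only [kernelTerm, kernelFiber]
  generalize q ^ (triExp (2 * p.1 + ℓ - r) + p.1
    + p.2 * ((k + 2) * p.2 + (k + 2) - (r + 1 - 2 * p.1))) = z
  generalize r - (p.1 + (k + 2) * p.2 - σ) = x
  generalize p.1 + (k + 2) * p.2 - σ = y
  generalize 2 * p.1 + ℓ - r = m
  have h1 := hasSum_durfeeTerm hq0 hq1 m
  have h2 := hasSum_pairTerm hq1 x y
  have h3 := (hasSum_int_mul_int h1 h2).mul_right z
  have hne := qPochInf_ne_zero hq1
  have e : durfeeSum q m * pairSum q x y * z = z * (chargeSum q y * chargeSum q x) := by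
    rw [durfeeSum_eq hq0 hq1, pairSum_eq hq0 hq1]
    field_simp
  rw [← e]
  exact h3

theorem hasSum_kernelFiber (hq0 : q ≠ 0) (hq1 : ‖q‖ < 1) (k ℓ : ℕ) (r σ : ℤ) :
    HasSum (kernelFiber k ℓ r σ q) (∑' p, kernelTerm k ℓ r σ q p) := by
  have h := ((Equiv.prodComm (ℤ × ℤ) (ℤ × ℤ)).hasSum_iff (f := kernelTerm k ℓ r σ q)).mpr
    (summable_kernelTerm hq0 hq1 k ℓ r σ).hasSum
  exact h.prod_fiberwise fun p => hasSum_kernelTerm_fiber hq0 hq1 k ℓ r σ p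

/-- The change of variables from `(j, a)` to the indices of the first half of the kernel. -/
def directIndex (k : ℕ) : ℤ × ℤ ≃ ℤ × ℤ where
  toFun p := (p.2 + (k + 2) * p.1, -p.1)
  invFun p := (-p.2, p.1 + (k + 2) * p.2)
  left_inv p := by ext <;> simp
  right_inv p := by ext <;> simp

/-- The change of variables from `(j, a)` to the indices of the second half of the kernel. -/
def reflectedIndex (k : ℕ) (r : ℤ) : ℤ × ℤ ≃ ℤ × ℤ where
  toFun p := (r - p.2 + (k + 2) * p.1 + 1, -p.1 - 1)
  invFun p := (-p.2 - 1, r - p.1 - (k + 2) * (p.2 + 1) + 1)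
  left_inv p := by ext <;> dsimp only <;> ring
  right_inv p := by ext <;> dsimp only <;> ring

/-- The exponent `j ((2k + 3) j + 2ℓ + 1) / 2` of the bosonic sum. -/
def psiExp (k ℓ : ℕ) (j : ℤ) : ℤ := j * ((2 * k + 3) * j + 2 * ℓ + 1) / 2

theorem two_mul_psiExp (k ℓ : ℕ) (j : ℤ) :
    2 * psiExp k ℓ j = j * ((2 * k + 3) * j + 2 * ℓ + 1) := by
  apply Int.mul_ediv_cancel'
  rcases Int.even_or_odd' j with ⟨c, rfl | rfl⟩
  · exact ⟨c * ((2 * k + 3) * (2 * c) + 2 * ℓ + 1), by ring⟩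
  · exact ⟨(2 * c + 1) * ((2 * k + 3) * c + k + ℓ + 2), by ring⟩

theorem kernelFiber_directIndex (hq0 : q ≠ 0) (k ℓ : ℕ) (r : ℤ) :
    kernelFiber k ℓ r 0 q ∘ directIndex k
      = fun p : ℤ × ℤ => q ^ psiExp k ℓ p.1
        * truncTerm q r (r - ℓ - (2 * k + 3) * p.1) p.2 := by
  funext ⟨j, a⟩
  have e : a + ((k : ℤ) + 2) * j + (k + 2) * -j - 0 = a := by ring
  have e' : triExp (2 * (a + (k + 2) * j) + ℓ - r) + (a + (k + 2) * j)
        + -j * ((k + 2) * -j + (k + 2) - (r + 1 - 2 * (a + (k + 2) * j)))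
      = psiExp k ℓ j
        + (triExp (2 * a - (r - ℓ - (2 * k + 3) * j)) + a) := by
    apply eq_of_two_mul_eq
    linear_combination two_mul_triExp (2 * (a + (k + 2) * j) + ℓ - r) - two_mul_psiExp k ℓ j
      - two_mul_triExp (2 * a - (r - ℓ - (2 * k + 3) * j))
  simp only [Function.comp, kernelFiber, directIndex, Equiv.coe_fn_mk, truncTerm, e, e']
  rw [zpow_add₀ hq0, mul_assoc]

/-- Here the charge is r - a instead of a. The product of charge sums does not see this, while the
exponent becomes that of the reflected label 2r+1-t. -/
theorem kernelFiber_reflectedIndex (hq0 : q ≠ 0) (k ℓ : ℕ) (r : ℤ) :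
    kernelFiber k ℓ r (-k - 1) q ∘ reflectedIndex k r
      = fun p : ℤ × ℤ => q ^ psiExp k ℓ p.1
        * truncTerm q r (2 * r + 1 - (r - ℓ - (2 * k + 3) * p.1)) p.2 := by
  funext ⟨j, a⟩
  have e : r - a + ((k : ℤ) + 2) * j + 1 + (k + 2) * (-j - 1) - (-k - 1) = r - a := by ring
  have e' : triExp (2 * (r - a + (k + 2) * j + 1) + ℓ - r) + (r - a + (k + 2) * j + 1)
        + (-j - 1) * ((k + 2) * (-j - 1) + (k + 2) - (r + 1 - 2 * (r - a + (k + 2) * j + 1)))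
      = psiExp k ℓ j
        + (triExp (2 * a - (2 * r + 1 - (r - ℓ - (2 * k + 3) * j))) + a) := by
    apply eq_of_two_mul_eq
    linear_combination two_mul_triExp (2 * (r - a + (k + 2) * j + 1) + ℓ - r)
      - two_mul_psiExp k ℓ j
      - two_mul_triExp (2 * a - (2 * r + 1 - (r - ℓ - (2 * k + 3) * j)))
  simp only [Function.comp, kernelFiber, reflectedIndex, Equiv.coe_fn_mk, truncTerm, e, e',
    sub_sub_cancel]
  rw [zpow_add₀ hq0, mul_assoc, mul_comm (chargeSum q a)]

theorem summable_truncTerm (hq0 : q ≠ 0) (hq1 : ‖q‖ < 1) (r t : ℤ) :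
    Summable (truncTerm q r t) := by
  obtain ⟨C, hC, hE⟩ := exists_norm_chargeSum_le hq1
  have : Summable fun a => truncTerm q r t a := by
    simpa [truncTerm] using summable_zpow_triExp_mul hq0 hq1 t 1 0
      (f := fun a => chargeSum q a * chargeSum q (r - a)) (C := C * C) fun a => by
        rw [norm_mul]; gcongr <;> apply hE
  exact this

theorem hasSum_psiTerm (hq0 : q ≠ 0) (hq1 : ‖q‖ < 1) (k ℓ : ℕ) (r : ℤ) :
    HasSum (psiTerm k ℓ r q) (qPochInf q
      * (∑' p, kernelTerm k ℓ r 0 q p - ∑' p, kernelTerm k ℓ r (-k - 1) q p)) := by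
  have a1 := ((directIndex k).hasSum_iff (f := kernelFiber k ℓ r 0 q)).mpr
    (hasSum_kernelFiber hq0 hq1 k ℓ r 0)
  have a2 := ((reflectedIndex k r).hasSum_iff (f := kernelFiber k ℓ r (-k - 1) q)).mpr
    (hasSum_kernelFiber hq0 hq1 k ℓ r (-k - 1))
  rw [kernelFiber_directIndex hq0] at a1
  rw [kernelFiber_reflectedIndex hq0] at a2
  have h1 := a1.prod_fiberwise fun j =>
    (summable_truncTerm hq0 hq1 r (r - ℓ - (2 * k + 3) * j)).hasSum.mul_left
      (q ^ psiExp k ℓ j)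
  have h2 := a2.prod_fiberwise fun j =>
    (summable_truncTerm hq0 hq1 r (2 * r + 1 - (r - ℓ - (2 * k + 3) * j))).hasSum.mul_left
      (q ^ psiExp k ℓ j)
  have h3 := (h1.sub h2).mul_left (qPochInf q)
  have e : psiTerm k ℓ r q = fun j => qPochInf q
      * (q ^ psiExp k ℓ j
          * ∑' a, truncTerm q r (r - ℓ - (2 * k + 3) * j) a
        - q ^ psiExp k ℓ j
          * ∑' a, truncTerm q r (2 * r + 1 - (r - ℓ - (2 * k + 3) * j)) a) := by
    funext j
    have hv := verma_sub_verma hq0 hq1 r (r - ℓ - (2 * k + 3) * j)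
    rw [psiTerm, ← psiExp, show r + ℓ + 1 + (2 * k + 3) * j = 2 * r + 1 - (r - ℓ - (2 * k + 3) * j) by ring,
      hv]
    ring
  rw [e]
  exact h3

end Kernel

/-! ### Summation of the fourfold series to configuration sums -/

section Folding

variable {q : ℂ}

/-- The factor of the kernel that does not depend on `j`, at `d = w - u`. -/
noncomputable def alcoveWeight (ℓ : ℕ) (r : ℤ) (q : ℂ) (w L u : ℤ) : ℂ :=
  durfeeTerm q (2 * u + ℓ - r) (w - u) * (q ^ L * qPochInv q L * qPochInv q (L + r))
    * q ^ (triExp (2 * u + ℓ - r) + u)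

/-- In `pairWeight` the factors (q)_{2L+r} / ((q)_{L+r-y} (q)_{L+y}), with y = u + (k+2)j, form a
binomial; the others do not involve j. -/
theorem kernelTerm_zero_eq (hq0 : q ≠ 0) (k ℓ : ℕ) (r w L u j : ℤ) :
    kernelTerm k ℓ r 0 q ((w - u, L), (u, j)) = alcoveWeight ℓ r q w L u
      * (q ^ (j * ((k + 2) * j + (k + 2) - (r + 1 - 2 * u)))
        * qBinom q (2 * L + r) ((2 * L + r + (r + 1 - 2 * u) - 1) / 2 - (k + 2) * j)) := by
  have e1 : (2 * L + r + (r + 1 - 2 * u) - 1) / 2 = L + r - u := by lia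
  have e2 : r - (u + ((k : ℤ) + 2) * j - 0) + (u + (k + 2) * j - 0) = r := by ring
  have e3 : L + r - u - ((k : ℤ) + 2) * j = L + (r - (u + (k + 2) * j - 0)) := by ring
  have e4 : 2 * L + r - (L + (r - (u + ((k : ℤ) + 2) * j - 0))) = L + (u + (k + 2) * j - 0) := by
    ring
  simp only [kernelTerm, alcoveWeight, pairWeight, qBinom_eq, e1, e2, e3, e4]
  rw [zpow_add₀ hq0 (triExp _ + u)]
  ring

/-- The substitution j ↦ -j-1 together with σ = -k-1 gives y = u - 1 - (k+2)j, which matches the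
lower index in the second half of the configuration sum. -/
theorem kernelTerm_reflected_eq (hq0 : q ≠ 0) (k ℓ : ℕ) (r w L u j : ℤ) :
    kernelTerm k ℓ r (-k - 1) q ((w - u, L), (u, -j - 1)) = alcoveWeight ℓ r q w L u
      * (q ^ (r + 1 - 2 * u) * (q ^ (j * ((k + 2) * j + (k + 2) - -(r + 1 - 2 * u)))
        * qBinom q (2 * L + r) ((2 * L + r + -(r + 1 - 2 * u) - 1) / 2 - (k + 2) * j))) := by
  have e1 : (2 * L + r + -(r + 1 - 2 * u) - 1) / 2 = L + u - 1 := by lia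
  set y : ℤ := u + (k + 2) * (-j - 1) - (-k - 1) with hy
  have e2 : r - y + y = r := by ring
  have e3 : L + u - 1 - ((k : ℤ) + 2) * j = L + y := by rw [hy]; ring
  have e4 : 2 * L + r - (L + y) = L + (r - y) := by ring
  have e5 : q ^ (triExp (2 * u + ℓ - r) + u
        + (-j - 1) * ((k + 2) * (-j - 1) + (k + 2) - (r + 1 - 2 * u)))
      = q ^ (triExp (2 * u + ℓ - r) + u) * q ^ (r + 1 - 2 * u)
        * q ^ (j * ((k + 2) * j + (k + 2) - -(r + 1 - 2 * u))) := by
    rw [← zpow_add₀ hq0, ← zpow_add₀ hq0]; congr 1; ring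
  simp only [kernelTerm, alcoveWeight, pairWeight, qBinom_eq, e1, e3, e4, ← hy, e2, e5]
  ring

theorem hasSum_kernelTerm_sub (hq0 : q ≠ 0) (k ℓ : ℕ) (r w L u : ℤ) :
    HasSum (fun j => kernelTerm k ℓ r 0 q ((w - u, L), (u, j))
        - kernelTerm k ℓ r (-k - 1) q ((w - u, L), (u, j)))
      (alcoveWeight ℓ r q w L u * configSum 1 (k + 2) 1 (r + 1 - 2 * u) (2 * L + r) 1 q) := by
  have hP : (0 : ℤ) < k + 2 := by positivity
  have h1 : HasSum (fun j => kernelTerm k ℓ r 0 q ((w - u, L), (u, j)))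
      (alcoveWeight ℓ r q w L u * configHalf (k + 2) (r + 1 - 2 * u) (2 * L + r) 1 q) := by
    simp only [kernelTerm_zero_eq hq0]
    exact (summable_configHalf hP (r + 1 - 2 * u) (2 * L + r) 1 q).hasSum.mul_left _
  have h2 : HasSum (fun j => kernelTerm k ℓ r (-k - 1) q ((w - u, L), (u, -j - 1)))
      (alcoveWeight ℓ r q w L u
        * (q ^ (r + 1 - 2 * u) * configHalf (k + 2) (-(r + 1 - 2 * u)) (2 * L + r) 1 q)) := by
    simp only [kernelTerm_reflected_eq hq0]
    exact ((summable_configHalf hP (-(r + 1 - 2 * u)) (2 * L + r) 1 q).hasSum.mul_left _).mul_left _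
  have h3 : HasSum (fun j => kernelTerm k ℓ r (-k - 1) q ((w - u, L), (u, j)))
      (alcoveWeight ℓ r q w L u
        * (q ^ (r + 1 - 2 * u) * configHalf (k + 2) (-(r + 1 - 2 * u)) (2 * L + r) 1 q)) := by
    refine (((Equiv.neg ℤ).trans (Equiv.subRight 1)).hasSum_iff
      (f := fun j => kernelTerm k ℓ r (-k - 1) q ((w - u, L), (u, j)))).mp ?_
    exact h2
  rw [configSum_eq hq0 hP, mul_sub]
  exact h1.sub h3

/-- The double sum over the integers into which the kernel is folded. -/
noncomputable def foldedTerm (k ℓ : ℕ) (r : ℤ) (q : ℂ) (x : ℤ × ℤ) : ℂ :=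
  ∑' u : ℤ, alcoveWeight ℓ r q x.1 x.2 u
    * configSum 1 (k + 2) 1 (r + 1 - 2 * u) (2 * x.2 + r) 1 q

theorem hasSum_foldedTerm (hq0 : q ≠ 0) (hq1 : ‖q‖ < 1) (k ℓ : ℕ) (r : ℤ) :
    HasSum (foldedTerm k ℓ r q)
      (∑' p, kernelTerm k ℓ r 0 q p - ∑' p, kernelTerm k ℓ r (-k - 1) q p) := by
  have h1 := (shearCharge.hasSum_iff (f := kernelTerm k ℓ r 0 q)).mpr
    (summable_kernelTerm hq0 hq1 k ℓ r 0).hasSum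
  have h2 := (shearCharge.hasSum_iff (f := kernelTerm k ℓ r (-k - 1) q)).mpr
    (summable_kernelTerm hq0 hq1 k ℓ r (-k - 1)).hasSum
  have h := h1.sub h2
  refine h.prod_fiberwise fun x => ?_
  have hx := (h.summable.prod_factor x).hasSum
  have hu := hx.prod_fiberwise fun u => hasSum_kernelTerm_sub hq0 k ℓ r x.1 x.2 u
  rw [foldedTerm, hu.tsum_eq]
  exact hx

theorem alcoveWeight_of_neg_left (ℓ : ℕ) (r : ℤ) (q : ℂ) {w : ℤ} (L u : ℤ)
    (h : 2 * w + ℓ - r < 0) : alcoveWeight ℓ r q w L u = 0 := by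
  rcases lt_or_ge (w - u) 0 with hd | hd
  · rw [alcoveWeight, durfeeTerm_of_neg q _ hd, zero_mul, zero_mul]
  · rw [alcoveWeight, durfeeTerm_of_add_neg q _ (by lia), zero_mul, zero_mul]

theorem foldedTerm_eq_zero (k ℓ : ℕ) (r : ℤ) (q : ℂ) {w L : ℤ} (h : 2 * w + ℓ - r < 0 ∨ L < 0) :
    foldedTerm k ℓ r q (w, L) = 0 := by
  rw [foldedTerm]
  refine (tsum_congr fun u => ?_).trans tsum_zero
  rcases h with h | h
  · rw [alcoveWeight_of_neg_left ℓ r q L u h, zero_mul]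
  · simp [alcoveWeight, qPochInv_of_neg q h]

/-- With d = w - u, the Durfee denominators are (q)_d (q)_{n-d}. Inverting the base of the binomial
supplies q^{-d(n-d)}, which makes the remaining power of q independent of u. -/
theorem alcoveWeight_eq (hq0 : q ≠ 0) (hq1 : ‖q‖ < 1) (ℓ : ℕ) (r w L u : ℤ) (n : ℕ)
    (hn : (n : ℤ) = 2 * w + ℓ - r) :
    alcoveWeight ℓ r q w L u = q ^ (triExp n + w + L) * qPochInv q n * qPochInv q L
      * qPochInv q (L + r) * qBinom q⁻¹ n ((n + (r + 1 - 2 * u) - (ℓ + 1)) / 2) := by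
  have e1 : ((n : ℤ) + (r + 1 - 2 * u) - (ℓ + 1)) / 2 = w - u := by lia
  have e2 : (n : ℤ) - (w - u) = w - u + (2 * u + ℓ - r) := by lia
  have e3 : q ^ (triExp n + w + L) * q ^ (-((w - u) * (w - u + (2 * u + ℓ - r))))
      = q ^ ((w - u) * (w - u + (2 * u + ℓ - r))) * q ^ L * q ^ (triExp (2 * u + ℓ - r) + u) := by
    simp only [← zpow_add₀ hq0]
    congr 1
    apply eq_of_two_mul_eq
    rw [hn]
    linear_combination two_mul_triExp (2 * w + ℓ - r) - two_mul_triExp (2 * u + ℓ - r)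
  have e4 := qPoch_toNat_mul_qPochInv hq1 (Int.natCast_nonneg n)
  rw [alcoveWeight, qBinom_inv hq0 hq1, e1, e2, qBinom_eq, e2, durfeeTerm]
  linear_combination (-(qPochInv q L * qPochInv q (L + r) * qPochInv q (w - u)
      * qPochInv q (w - u + (2 * u + ℓ - r)) * qPochInv q n * qPoch q (n : ℤ).toNat)) * e3
    - (q ^ ((w - u) * (w - u + (2 * u + ℓ - r))) * q ^ L * q ^ (triExp (2 * u + ℓ - r) + u)
      * qPochInv q L * qPochInv q (L + r) * qPochInv q (w - u)
      * qPochInv q (w - u + (2 * u + ℓ - r))) * e4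

end Folding

/-! ### Rational powers of q, the coupled double sum and the symmetries -/

section Nome

theorem qpow_add (τ : ℂ) (a b : ℚ) : qpow τ (a + b) = qpow τ a * qpow τ b := by
  rw [qpow, qpow, qpow, ← Complex.exp_add]
  push_cast
  ring_nf

theorem qpow_intCast (τ : ℂ) (n : ℤ) : qpow τ n = qpow τ 1 ^ n := by
  rw [qpow, qpow, ← Complex.exp_int_mul]
  push_cast
  ring_nf

theorem qpow_ne_zero (τ : ℂ) (a : ℚ) : qpow τ a ≠ 0 := Complex.exp_ne_zero _

theorem norm_qpow_one_lt_one {τ : ℂ} (hτ : 0 < τ.im) : ‖qpow τ 1‖ < 1 := by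
  rw [qpow, Complex.norm_exp, Real.exp_lt_one_iff]
  have : (2 * Real.pi * Complex.I * τ * ((1 : ℚ) : ℂ)).re = -(2 * Real.pi * τ.im) := by
    simp [Complex.mul_re]
  rw [this]
  have := Real.pi_pos
  exact neg_neg_of_pos (by positivity)

theorem coupledTerm_eq_foldedTerm {τ : ℂ} (hτ : 0 < τ.im) (k ℓ : ℕ) (r w : ℤ) (n L : ℕ)
    (hn : (n : ℤ) = 2 * w + ℓ - r) :
    coupledTerm k ℓ r τ n L = foldedTerm k ℓ r (qpow τ 1) (w, L) := by
  have hq0 := qpow_ne_zero τ 1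
  have hq1 := norm_qpow_one_lt_one hτ
  -- The half-integral parts combine: n²/2 = n(n-1)/2 + n/2, and n + r - ℓ = 2w.
  have hexp : qpow τ ((n : ℚ) ^ 2 / 2) * qpow τ ((2 * L + r - ℓ) / 2)
      = qpow τ 1 ^ (triExp n + w + L) := by
    rw [← qpow_add, ← qpow_intCast]
    congr 1
    have h1 : (2 : ℚ) * triExp n = n * (n - 1) := by exact_mod_cast two_mul_triExp n
    have h2 : (n : ℚ) = 2 * w + ℓ - r := by exact_mod_cast hn
    push_cast
    linear_combination (-1 / 2 : ℚ) * h1 + (1 / 2 : ℚ) * h2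
  rw [coupledTerm, sum_configSum_mul_configSum hq0, foldedTerm, ← tsum_mul_left, ← tsum_mul_left]
  refine tsum_congr fun u => ?_
  rw [alcoveWeight_eq hq0 hq1 ℓ r w L u n hn, ← hexp, qPochInv_natCast _ n]
  ring

theorem hasSum_coupledTerm {τ : ℂ} (hτ : 0 < τ.im) (k ℓ : ℕ) (r : ℤ) :
    HasSum (fun x : ℕ × ℕ =>
        if (x.1 : ℤ) ≡ r + ℓ [ZMOD 2] then coupledTerm k ℓ r τ x.1 x.2 else 0)
      (∑' p, kernelTerm k ℓ r 0 (qpow τ 1) p - ∑' p, kernelTerm k ℓ r (-k - 1) (qpow τ 1) p) := by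
  set q := qpow τ 1 with hq
  set T := ∑' p, kernelTerm k ℓ r 0 q p - ∑' p, kernelTerm k ℓ r (-k - 1) q p
  set f : ℤ × ℤ → ℂ := fun x =>
    if x.1 ≡ r + ℓ [ZMOD 2] then foldedTerm k ℓ r q ((x.1 + r - ℓ) / 2, x.2) else 0 with hf
  set ι : ℤ × ℤ → ℤ × ℤ := fun x => (2 * x.1 + ℓ - r, x.2) with hι
  have hιinj : Function.Injective ι := by
    rintro ⟨a, b⟩ ⟨a', b'⟩ h
    simp only [hι, Prod.mk.injEq] at h ⊢
    lia
  have hcomp : f ∘ ι = foldedTerm k ℓ r q := by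
    funext ⟨w, L⟩
    simp only [Function.comp, hf, hι]
    rw [if_pos (by simp only [Int.ModEq]; lia)]
    congr 2
    lia
  have h1 : HasSum f T := by
    refine (hιinj.hasSum_iff ?_).mp (hcomp ▸ hasSum_foldedTerm (qpow_ne_zero τ 1)
      (norm_qpow_one_lt_one hτ) k ℓ r)
    rintro ⟨n, L⟩ hx
    simp only [hf]
    refine if_neg fun hmod => hx ⟨((n + r - ℓ) / 2, L), ?_⟩
    simp only [Int.ModEq] at hmod
    simp only [hι, Prod.mk.injEq, and_true]
    lia
  have hinj : Function.Injective fun x : ℕ × ℕ => ((x.1 : ℤ), (x.2 : ℤ)) := by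
    rintro ⟨a, b⟩ ⟨a', b'⟩ h
    simpa using h
  have h2 := (hinj.hasSum_iff (f := f) (by
    rintro ⟨n, L⟩ hx
    simp only [hf]
    split_ifs with hmod
    · refine foldedTerm_eq_zero k ℓ r q ?_
      by_contra! hcon
      refine hx ⟨(n.toNat, L.toNat), ?_⟩
      simp only [Int.ModEq] at hmod
      simp only [Prod.mk.injEq]
      lia
    · rfl)).mpr h1
  refine (congrArg (HasSum · T) (funext fun x => ?_)).mpr h2
  simp only [Function.comp, hf]
  split_ifs with hmod
  · exact coupledTerm_eq_foldedTerm hτ k ℓ r _ x.1 x.2 (by simp only [Int.ModEq] at hmod; lia)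
  · rfl

/-- The inner sum of the coupled representation. -/
noncomputable def innerTerm (k ℓ : ℕ) (r : ℤ) (τ : ℂ) (n : ℕ) (L : ℤ) : ℂ :=
  qpow τ ((2 * L + r - ℓ) / 2) * qPochInv (qpow τ 1) L * qPochInv (qpow τ 1) (L + r)
    * ∑ i ∈ (Finset.range (k + 1)).filter (fun i : ℕ => (i : ℤ) ≡ r [ZMOD 2]),
        configSum 1 (k + 2) 1 (i + 1) n (ℓ + 1) (qpow τ 1)⁻¹
          * configSum 1 (k + 2) 1 (i + 1) (2 * L + r) 1 (qpow τ 1)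

theorem psiB_eq {τ : ℂ} (hτ : 0 < τ.im) (k ℓ : ℕ) (r : ℤ) :
    psiB k ℓ r (qpow τ 1) = qPochInf (qpow τ 1)
      * ∑' n : ℕ, if (n : ℤ) ≡ r + ℓ [ZMOD 2] then
          qpow τ ((n : ℚ) ^ 2 / 2) / qPoch (qpow τ 1) n * ∑' L : ℕ, innerTerm k ℓ r τ n L
        else 0 := by
  have h := hasSum_coupledTerm hτ k ℓ r
  rw [psiB, (hasSum_psiTerm (qpow_ne_zero τ 1) (norm_qpow_one_lt_one hτ) k ℓ r).tsum_eq, ← h.tsum_eq,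
    h.summable.tsum_prod]
  congr 1
  refine tsum_congr fun n => ?_
  split_ifs
  · rw [← tsum_mul_left]
    rfl
  · exact tsum_zero

/-- Since 1/(q)_L vanishes for L < 0, the sum may run over all integers. The shift L ↦ L + r then
swaps 1/(q)_L and 1/(q)_{L+r}, and the rest depends only on 2L+r and the parity of r. -/
theorem tsum_innerTerm_neg (k ℓ : ℕ) (r : ℤ) (τ : ℂ) (n : ℕ) :
    ∑' L : ℕ, innerTerm k ℓ (-r) τ n L = ∑' L : ℕ, innerTerm k ℓ r τ n L := by
  have hZ : ∀ r : ℤ, ∑' L : ℕ, innerTerm k ℓ r τ n L = ∑' L : ℤ, innerTerm k ℓ r τ n L := fun r =>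
    Function.Injective.tsum_eq (f := innerTerm k ℓ r τ n) Nat.cast_injective fun L hL => by
      refine ⟨L.toNat, Int.toNat_of_nonneg ?_⟩
      by_contra! h
      exact hL (by simp [innerTerm, qPochInv_of_neg _ h])
  rw [hZ, hZ, ← (Equiv.addRight r).tsum_eq]
  refine tsum_congr fun L => ?_
  have hmod : ∀ i : ℕ, ((i : ℤ) ≡ -r [ZMOD 2]) ↔ (i : ℤ) ≡ r [ZMOD 2] := fun i => by
    simp only [Int.ModEq]; lia
  have e1 : L + r + -r = L := by ring
  have e2 : 2 * (L + r) + -r = 2 * L + r := by ring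
  have e3 : (2 * ((L + r : ℤ) : ℚ) + ((-r : ℤ) : ℚ) - ℓ) / 2 = (2 * L + r - ℓ) / 2 := by
    push_cast; ring
  simp only [innerTerm, Equiv.coe_addRight, hmod, e1, e2, e3]
  ring

theorem psiB_neg {τ : ℂ} (hτ : 0 < τ.im) (k ℓ : ℕ) (r : ℤ) :
    psiB k ℓ (-r) (qpow τ 1) = psiB k ℓ r (qpow τ 1) := by
  rw [psiB_eq hτ, psiB_eq hτ]
  have hmod : ∀ n : ℕ, ((n : ℤ) ≡ -r + ℓ [ZMOD 2]) ↔ (n : ℤ) ≡ r + ℓ [ZMOD 2] := fun n => by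
    simp only [Int.ModEq]; lia
  simp only [hmod, tsum_innerTerm_neg]

/-- Completing the square in the exponent of ψ^B leaves the constant (2ℓ+1)²/(8(2k+3)), and the
Verma labels agree after r ↦ r + ℓ. -/
theorem chiTerm_eq (k ℓ : ℕ) (r : ℤ) (τ : ℂ) :
    chiTerm k ℓ r τ = fun j => qpow τ ((2 * ℓ + 1) ^ 2 / (8 * (2 * k + 3)))
      * psiTerm k ℓ (r + ℓ) (qpow τ 1) j := by
  funext j
  have hexp : qpow τ ((2 * k + 3) / 2 * (j + (2 * ℓ + 1) / (2 * (2 * k + 3))) ^ 2)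
      = qpow τ ((2 * ℓ + 1) ^ 2 / (8 * (2 * k + 3))) * qpow τ 1 ^ psiExp k ℓ j := by
    rw [← qpow_intCast, ← qpow_add]
    congr 1
    have h : (2 : ℚ) * psiExp k ℓ j = j * ((2 * k + 3) * j + 2 * ℓ + 1) := by
      exact_mod_cast two_mul_psiExp k ℓ j
    have hN : (2 * k + 3 : ℚ) ≠ 0 := by positivity
    rw [show (psiExp k ℓ j : ℚ) = j * ((2 * k + 3) * j + 2 * ℓ + 1) / 2 by linarith]
    field_simp
    ring
  have e1 : r + ℓ - ℓ - (2 * k + 3) * j = r - (2 * k + 3) * j := by ring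
  have e2 : r + ℓ + ℓ + 1 + (2 * k + 3) * j = r + 2 * ℓ + 1 + (2 * k + 3) * j := by ring
  rw [chiTerm, psiTerm, hexp, ← psiExp, e1, e2, mul_assoc]

theorem chiB_eq (k ℓ : ℕ) (r : ℤ) (τ : ℂ) :
    chiB k ℓ r τ = qpow τ (-(ℓ + r) ^ 2 / (4 * k))
      * (qpow τ ((2 * ℓ + 1) ^ 2 / (8 * (2 * k + 3))) * psiB k ℓ (r + ℓ) (qpow τ 1)) := by
  rw [chiB, chiTerm_eq, tsum_mul_left, psiB]

end Nome

end GradedParafermion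

open GradedParafermion
theorem proposition1 (k : ℕ) (hk : 0 < k) (ℓ : ℕ) (hℓ : ℓ ≤ k) (τ : ℂ) (hτ : 0 < τ.im)
    (q : ℂ) (hq : q = qpow τ 1) :
    -- all infinite products and sums involved converge (absolutely)
    (Multipliable fun i : ℕ => 1 - q ^ (i + 1)) ∧
    (∀ t : ℤ, Summable (vermaTerm t q)) ∧
    (∀ r : ℤ, Summable (psiTerm k ℓ r q)) ∧
    (∀ r : ℤ, Summable (chiTerm k ℓ r τ)) ∧
    (∀ r : ℤ, Summable fun nL : ℕ × ℕ =>
      if (nL.1 : ℤ) ≡ r + ℓ [ZMOD 2] then coupledTerm k ℓ r τ nL.1 nL.2 else 0) ∧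
    -- the identity for the bosonic sum
    (∀ r : ℤ, psiB k ℓ r q =
      qPochInf q * ∑' n : ℕ, if (n : ℤ) ≡ r + ℓ [ZMOD 2] then
        qpow τ ((n : ℚ) ^ 2 / 2) / qPoch q n
          * ∑' L : ℕ, qpow τ ((2 * L + r - ℓ) / 2) * qPochInv q L * qPochInv q (L + r)
            * ∑ i ∈ (Finset.range (k + 1)).filter (fun i : ℕ => (i : ℤ) ≡ r [ZMOD 2]),
                configSum 1 (k + 2) 1 (i + 1) n (ℓ + 1) q⁻¹
                  * configSum 1 (k + 2) 1 (i + 1) (2 * L + r) 1 q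
        else 0) ∧
    -- the resulting symmetries of the bosonic sum and of the characters
    (∀ r : ℤ, psiB k ℓ r q = psiB k ℓ (-r) q) ∧
    (∀ r : ℤ, chiB k ℓ r τ = chiB k ℓ (-r - 2 * ℓ) τ) := by
  subst hq
  have hq0 := qpow_ne_zero τ 1
  have hq1 := norm_qpow_one_lt_one hτ
  refine ⟨multipliable_one_sub_pow_succ hq1, summable_vermaTerm hq0 hq1,
    fun r => (hasSum_psiTerm hq0 hq1 k ℓ r).summable, fun r => ?_,
    fun r => (hasSum_coupledTerm hτ k ℓ r).summable, psiB_eq hτ k ℓ,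
    fun r => (psiB_neg hτ k ℓ r).symm, fun r => ?_⟩
  · rw [chiTerm_eq]
    exact (hasSum_psiTerm hq0 hq1 k ℓ (r + ℓ)).summable.mul_left _
  · have e1 : -r - 2 * ℓ + ℓ = -(r + ℓ) := by ring
    have e2 : (-(ℓ + ((-r - 2 * ℓ : ℤ) : ℚ)) ^ 2 / (4 * k)) = -(ℓ + r) ^ 2 / (4 * k) := by
      push_cast; ring
    rw [chiB_eq, chiB_eq, e1, e2, psiB_neg hτ]
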